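/- **Conventions.** All spaces are simplicial sets. $N\mathbb{Z}_2$ is the nerve of $\mathbb{Z}_2$ (its $n$-simplices are $\mathbb{Z}_2^n$), and $D(Y)$ is the simplicial set whose $n$-simplices are the finitely supported probability distributions on $Y_n$, with simplicial operators acting by push-forward. A *simplicial distribution* on $X$ is a simplicial map $p:X\to D(N\mathbb{Z}_2)$. It is *non-contextual* if there is a finitely supported probability distribution $d$ on the set of simplicial maps $s:X\to N\mathbb{Z}_2$ with $p_\sigma=\sum_s d(s)\,\delta^{s_\sigma}$ for every simplex $\sigma$ of $X$. For an edge $\tau$ write $\bar\tau=p_\tau(0)-p_\tau(1)$. For $N\ge 1$, an *$N$-circle* $C_N$ is the simplicial set generated by edges $\tau_1,\dots,\tau_N$ with identifying relations $d_{i'_k}\tau_k=d_{i_{k+1}}\tau_{k+1}$ (indices mod $N$), where $i_k\ne i'_k\in\{0,1\}$ are chosen for each $k$. The *$N$-cycle scenario* is its cone $\tilde C_N=\mathrm{Cone}(C_N)$. A simplicial distribution on $C_N$ satisfies the *$N$-circle inequalities* if $$0\le N-2+\sum_{k=1}^N(-1)^{a_k}\bar\tau_k\qquad\text{for all }a\in\mathbb{Z}_2^N\text{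 with }\sum_k a_k=N+1 \bmod 2 .$$ For $N\ge3$, a *classical $N$-disk* $D_N$ is the simplicial set generated by triangles $\sigma_1,\dots,\sigma_{N-2}$ with identifying relations $d_{j'_k}\sigma_k=d_{j_{k+1}}\sigma_{k+1}$ for $1\le k\le N-3$, where the indices lie in $\{0,1,2\}$ and $j_k\neq j'_k$ for $2\le k\le N-3$. Its boundary $\partial D_N$ is the simplicial subset generated by the faces $d_f\sigma_k$ that occur in none of the identifying relations. **Theorem (Fine's theorem for $N$-cycle scenarios).** Let $N\ge1$, let $C_N$ be an $N$-circle and let $p$ be a simplicial distribution on $\tilde C_N=\mathrm{Cone}(C_N)$. 1. $p$ is non-contextual if and only if its restriction $p|_{C_N}$ to the base of the cone satisfies the $N$-circle inequalities. 2. Suppose $N\ge3$, let $D_N$ be a classical $N$-disk, and let an isomorphism $C_N\cong\partial D_N$ be given. Then $p$ is non-contextual if and only if it extends to a simplicial distribution on $\tilde C_N\cup_{C_N}D_N$, the pushout of $\tilde C_N\leftarrow C_N\cong\partial D_N\hookrightarrow D_N$. -/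

import Mathlib

open CategoryTheory Opposite

noncomputable section

namespace SimplicialDist

/-! ### The outcome space `N ℤ₂` -/

/-- `∑_{j < t} a_j`. -/
def partialSum {n : ℕ} (a : Fin n → ZMod 2) (t : Fin (n + 1)) : ZMod 2 :=
  ∑ j : Fin n with j.castSucc < t, a j

/-- The operator `(θ^* a)_i = ∑_{θ(i-1) ≤ j < θ(i)} a_j` (the entries are indexed from `0`), which
adds up the consecutive entries between the images of two neighbouring vertices. On the coface maps
it drops the first entry, adds two neighbouring entries, or drops the last entry; on the
codegeneracy maps it inserts a zero. -/
def nerveMap {m n : ℕ} (θ : Fin (m + 1) →o Fin (n + 1)) (a : Fin n → ZMod 2) (i : Fin m) : ZMod 2 :=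
  ∑ j : Fin n with θ i.castSucc ≤ j.castSucc ∧ j.castSucc < θ i.succ, a j

theorem nerveMap_eq {m n : ℕ} (θ : Fin (m + 1) →o Fin (n + 1)) (a : Fin n → ZMod 2) (i : Fin m) :
    nerveMap θ a i = partialSum a (θ i.succ) - partialSum a (θ i.castSucc) := by
  have hle : θ i.castSucc ≤ θ i.succ := θ.monotone i.castSucc_lt_succ.le
  rw [eq_sub_iff_add_eq, nerveMap, partialSum, partialSum, ← Finset.sum_union]
  · congr 1
    ext j
    simp only [Finset.mem_union, Finset.mem_filter, Finset.mem_univ, true_and]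
    constructor
    · rintro (h | h)
      · exact h.2
      · exact lt_of_lt_of_le h hle
    · intro h
      rcases lt_or_ge j.castSucc (θ i.castSucc) with h' | h'
      · exact Or.inr h'
      · exact Or.inl ⟨h', h⟩
  · rw [Finset.disjoint_left]
    intro j hj hj'
    simp only [Finset.mem_filter, Finset.mem_univ, true_and] at hj hj'
    exact absurd hj' (not_lt.2 hj.1)

theorem partialSum_succ {n : ℕ} (a : Fin n → ZMod 2) (t : Fin n) :
    partialSum a t.succ = partialSum a t.castSucc + a t := by
  have : (Finset.univ.filter fun j : Fin n => j.castSucc < t.succ)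
      = insert t (Finset.univ.filter fun j : Fin n => j.castSucc < t.castSucc) := by
    ext j
    simp only [Finset.mem_insert, Finset.mem_filter, Finset.mem_univ, true_and, Fin.lt_def,
      Fin.ext_iff, Fin.val_castSucc, Fin.val_succ]
    omega
  rw [partialSum, this, Finset.sum_insert (by simp), add_comm, partialSum]

theorem partialSum_nerveMap {m n : ℕ} (θ : Fin (m + 1) →o Fin (n + 1)) (a : Fin n → ZMod 2)
    (t : Fin (m + 1)) :
    partialSum (nerveMap θ a) t = partialSum a (θ t) - partialSum a (θ 0) := by
  induction t using Fin.induction with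
  | zero => simp [partialSum]
  | succ t ih => rw [partialSum_succ, ih, nerveMap_eq]; ring

/-- The nerve of the group `ℤ₂`: its `n`-simplices are the elements of `ℤ₂^n`. -/
def nerveZ2 : SSet.{0} where
  obj U := Fin U.unop.len → ZMod 2
  map f := TypeCat.ofHom (nerveMap f.unop.toOrderHom)
  map_id U := by
    refine ConcreteCategory.hom_ext _ _ fun a => funext fun i => ?_
    change nerveMap OrderHom.id a i = a i
    rw [nerveMap_eq]
    simp [partialSum_succ]
  map_comp f g := by
    refine ConcreteCategory.hom_ext _ _ fun a => funext fun i => ?_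
    change nerveMap (f.unop.toOrderHom.comp g.unop.toOrderHom) a i
      = nerveMap g.unop.toOrderHom (nerveMap f.unop.toOrderHom a) i
    simp only [nerveMap_eq, partialSum_nerveMap, OrderHom.comp_coe, Function.comp_apply]
    ring

/-! ### Simplicial distributions and contextuality -/

/-- The space `D(Y)` of distributions on `Y`: its `n`-simplices are the finitely supported
probability distributions on `Y_n`, and simplicial operators act by push-forward. -/
def distSpace (Y : SSet.{0}) : SSet.{0} where
  obj U := Convexity.StdSimplex ℝ (Y.obj U)
  map f := TypeCat.ofHom (Convexity.StdSimplex.map (Y.map f))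
  map_id U := by
    refine ConcreteCategory.hom_ext _ _ fun p => ?_
    change Convexity.StdSimplex.map (Y.map (𝟙 U)) p = p
    have h : (Y.map (𝟙 U) : Y.obj U → Y.obj U) = id := by
      funext y
      simp
    rw [h, Convexity.StdSimplex.map_id]
  map_comp f g := by
    refine ConcreteCategory.hom_ext _ _ fun p => ?_
    change Convexity.StdSimplex.map (Y.map (f ≫ g)) p
      = Convexity.StdSimplex.map (Y.map g) (Convexity.StdSimplex.map (Y.map f) p)
    rw [Convexity.StdSimplex.map_map]
    congr 1
    funext y
    simp

/-- Simplicial distributions on the scenario `(X, Y)`. -/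
abbrev SDist (X Y : SSet.{0}) : Type := X ⟶ distSpace Y

/-- The map `Θ` sending a finitely supported distribution `d` on outcome assignments `s : X ⟶ Y`
(equivalently, on deterministic distributions) to the simplicial distribution
`σ ↦ ∑_s d(s) δ^{s_σ}`. -/
def Theta {X Y : SSet.{0}} (d : Convexity.StdSimplex ℝ (X ⟶ Y)) : SDist X Y where
  app U := TypeCat.ofHom fun σ => d.map fun s => s.app U σ
  naturality U V f := by
    refine ConcreteCategory.hom_ext _ _ fun σ => ?_
    change d.map (fun s => s.app V (X.map f σ))
      = Convexity.StdSimplex.map (Y.map f) (d.map fun s => s.app U σ)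
    rw [Convexity.StdSimplex.map_map]
    congr 1
    funext s
    exact NatTrans.naturality_apply s f σ

/-- A simplicial distribution is non-contextual if it lies in the image of `Θ`. -/
def NonContextual {X Y : SSet.{0}} (p : SDist X Y) : Prop := p ∈ Set.range (Theta (X := X) (Y := Y))

section

open scoped Simplicial

/-- The expectation value `p_τ(0) - p_τ(1)` of an edge `τ`. -/
def expectation {X : SSet.{0}} (p : SDist X nerveZ2) (τ : X _⦋1⦌) : ℝ :=
  let w : Convexity.StdSimplex ℝ (Fin 1 → ZMod 2) := p.app (op ⦋1⦌) τ
  w.weights (fun _ => 0) - w.weights (fun _ => 1)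

end

/-! ### The cone -/

/-- The `n`-simplices of the cone on `X`: the simplex `c_n` on the cone point, and for `s + l = n`
the simplices whose first `s` vertices are the cone point and whose last `l + 1` vertices span an
`l`-simplex `x` of `X`. This is `x` itself for `s = 0`, and `(c_{s-1}, x)` for `s > 0`. -/
inductive ConeSimplex (X : SSet.{0}) (n : ℕ) : Type where
  | apex : ConeSimplex X n
  | upper (s l : ℕ) (h : s + l = n) (x : X.obj (op (SimplexCategory.mk l))) : ConeSimplex X n

/-- The number of vertices that `θ` sends to one of the first `s` vertices. -/
def lowerCard {m n : ℕ} (θ : Fin (m + 1) →o Fin (n + 1)) (s : ℕ) : ℕ :=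
  (Finset.univ.filter fun i => (θ i : ℕ) < s).card

theorem lt_lowerCard {m n : ℕ} (θ : Fin (m + 1) →o Fin (n + 1)) (s : ℕ) (i : Fin (m + 1)) :
    (i : ℕ) < lowerCard θ s ↔ (θ i : ℕ) < s := by
  constructor
  · intro h
    by_contra hi
    have : (Finset.univ.filter fun i => (θ i : ℕ) < s) ⊆ Finset.Iio i := by
      intro j hj
      simp only [Finset.mem_filter, Finset.mem_univ, true_and] at hj
      rw [Finset.mem_Iio]
      by_contra hji
      exact hi (lt_of_le_of_lt (θ.monotone (not_lt.1 hji)) hj)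
    have := Finset.card_le_card this
    rw [Fin.card_Iio] at this
    exact absurd h (not_lt.2 this)
  · intro h
    have : Finset.Iic i ⊆ (Finset.univ.filter fun i => (θ i : ℕ) < s) := by
      intro j hj
      simp only [Finset.mem_filter, Finset.mem_univ, true_and]
      exact lt_of_le_of_lt (θ.monotone (Finset.mem_Iic.1 hj)) h
    have := Finset.card_le_card this
    rw [Fin.card_Iic] at this
    exact this

/-- The restriction of `θ` to the vertices that it sends to the last `l + 1` vertices. -/
def upperRestrict {m n : ℕ} (θ : Fin (m + 1) →o Fin (n + 1)) {s l : ℕ} (h : s + l = n)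
    (hc : lowerCard θ s ≤ m) :
    SimplexCategory.mk (m - lowerCard θ s) ⟶ SimplexCategory.mk l :=
  SimplexCategory.mkHom
    { toFun := fun i => ⟨(θ ⟨i + lowerCard θ s, by omega⟩ : ℕ) - s, by omega⟩
      monotone' := fun i j hij => by
        simp only [Fin.mk_le_mk]
        refine Nat.sub_le_sub_right (θ.monotone ?_) s
        simpa using hij }

/-- The simplicial operators of the cone. -/
def coneMap (X : SSet.{0}) {m n : ℕ} (θ : Fin (m + 1) →o Fin (n + 1)) :
    ConeSimplex X n → ConeSimplex X m
  | .apex => .apex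
  | .upper s _ h x =>
    if hc : lowerCard θ s ≤ m then
      .upper (lowerCard θ s) (m - lowerCard θ s) (Nat.add_sub_cancel' hc)
        (X.map (upperRestrict θ h hc).op x)
    else .apex

section

open scoped Simplicial

theorem upper_ext {X : SSet.{0}} {n s s' l l' k : ℕ} {h : s + l = n} {h' : s' + l' = n} {x : X _⦋k⦌}
    (f : ⦋l⦌ ⟶ ⦋k⦌) (g : ⦋l'⦌ ⟶ ⦋k⦌) (hs : s = s')
    (hfg : ∀ (i : ℕ) (hi : i < l + 1) (hi' : i < l' + 1),
      (f.toOrderHom ⟨i, hi⟩ : ℕ) = g.toOrderHom ⟨i, hi'⟩) :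
    ConeSimplex.upper s l h (X.map f.op x) = ConeSimplex.upper s' l' h' (X.map g.op x) := by
  subst hs
  obtain rfl : l = l' := by omega
  have : f = g := by
    ext i
    exact hfg i i.2 i.2
  rw [this]

theorem coneMap_id (X : SSet.{0}) {n : ℕ} (x : ConeSimplex X n) : coneMap X OrderHom.id x = x := by
  cases x with
  | apex => rfl
  | upper s l h x =>
    have hs : lowerCard (OrderHom.id : Fin (n + 1) →o Fin (n + 1)) s = s := by
      have h1 := lt_lowerCard (OrderHom.id : Fin (n + 1) →o Fin (n + 1)) s ⟨s, by omega⟩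
      simp only [OrderHom.id_coe, id_eq, lt_irrefl, iff_false, not_lt] at h1
      refine le_antisymm h1 ?_
      rcases Nat.eq_zero_or_pos s with h0 | h0
      · omega
      · have h2 := (lt_lowerCard (OrderHom.id : Fin (n + 1) →o Fin (n + 1)) s
          ⟨s - 1, by omega⟩).2 (by simp; omega)
        simp only at h2
        omega
    have hc : lowerCard (OrderHom.id : Fin (n + 1) →o Fin (n + 1)) s ≤ n := by omega
    have hx : x = X.map (𝟙 ⦋l⦌ : ⦋l⦌ ⟶ ⦋l⦌).op x := by simp
    conv_rhs => rw [hx]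
    rw [coneMap, dif_pos hc]
    refine upper_ext _ _ hs fun i hi hi' => ?_
    change i + lowerCard (OrderHom.id : Fin (n + 1) →o Fin (n + 1)) s - s = i
    omega

theorem coneMap_comp (X : SSet.{0}) {k m n : ℕ} (θ : Fin (m + 1) →o Fin (n + 1))
    (φ : Fin (k + 1) →o Fin (m + 1)) (x : ConeSimplex X n) :
    coneMap X (θ.comp φ) x = coneMap X φ (coneMap X θ x) := by
  cases x with
  | apex => rfl
  | upper s l h x =>
    have hs : lowerCard (θ.comp φ) s = lowerCard φ (lowerCard θ s) := by
      unfold lowerCard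
      congr 1
      ext i
      simp only [Finset.mem_filter, Finset.mem_univ, true_and, OrderHom.comp_coe,
        Function.comp_apply]
      exact (lt_lowerCard θ s (φ i)).symm
    by_cases hc : lowerCard θ s ≤ m
    · by_cases hc' : lowerCard φ (lowerCard θ s) ≤ k
      · have hc'' : lowerCard (θ.comp φ) s ≤ k := hs ▸ hc'
        simp only [coneMap, dif_pos hc, dif_pos hc', dif_pos hc'']
        rw [← Functor.map_comp_apply, ← op_comp]
        refine upper_ext _ _ hs fun i hi hi' => ?_
        have e : (⟨i + lowerCard (θ.comp φ) s, by omega⟩ : Fin (k + 1))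
            = ⟨i + lowerCard φ (lowerCard θ s), by omega⟩ := by simp [hs]
        have h3 := lt_lowerCard φ (lowerCard θ s) ⟨i + lowerCard φ (lowerCard θ s), by omega⟩
        have h4 : lowerCard θ s ≤ φ ⟨i + lowerCard φ (lowerCard θ s), by omega⟩ := by
          rw [← not_lt, ← h3]
          simp
        change (θ (φ ⟨i + lowerCard (θ.comp φ) s, _⟩) : ℕ) - s
          = (θ ⟨(φ ⟨i + lowerCard φ (lowerCard θ s), _⟩ : ℕ) - lowerCard θ s + lowerCard θ s, _⟩ : ℕ)
            - s
        rw [e]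
        congr 3
        ext
        simp only
        omega
      · have hc'' : ¬ lowerCard (θ.comp φ) s ≤ k := hs ▸ hc'
        simp only [coneMap, dif_pos hc, dif_neg hc', dif_neg hc'']
    · have hc'' : ¬ lowerCard (θ.comp φ) s ≤ k := by
        intro hle
        have h5 := lt_lowerCard (θ.comp φ) s (Fin.last k)
        have h6 := lt_lowerCard θ s (Fin.last m)
        have h7 : (θ (Fin.last m) : ℕ) < s := h6.1 (by simp; omega)
        have h8 : (θ (φ (Fin.last k)) : ℕ) < s :=
          lt_of_le_of_lt (θ.monotone (Fin.le_last _)) h7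
        have h9 := h5.2 h8
        simp only [Fin.val_last] at h9
        omega
      simp only [coneMap, dif_neg hc, dif_neg hc'']

/-- The cone on a simplicial set, with the cone point as initial vertex. -/
def cone (X : SSet.{0}) : SSet.{0} where
  obj U := ConeSimplex X U.unop.len
  map f := TypeCat.ofHom (coneMap X f.unop.toOrderHom)
  map_id U := ConcreteCategory.hom_ext _ _ fun x => coneMap_id X x
  map_comp f g := ConcreteCategory.hom_ext _ _ fun x =>
    coneMap_comp X f.unop.toOrderHom g.unop.toOrderHom x

/-- The inclusion of `X` as the base of its cone. -/
def coneBase (X : SSet.{0}) : X ⟶ cone X where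
  app U := TypeCat.ofHom fun x => ConeSimplex.upper 0 U.unop.len (Nat.zero_add _) x
  naturality U V f := by
    refine ConcreteCategory.hom_ext _ _ fun x => ?_
    change ConeSimplex.upper 0 V.unop.len (Nat.zero_add _) (X.map f x)
      = coneMap X f.unop.toOrderHom (ConeSimplex.upper 0 U.unop.len (Nat.zero_add _) x)
    have hs : lowerCard f.unop.toOrderHom 0 = 0 := by simp [lowerCard]
    have hc : lowerCard f.unop.toOrderHom 0 ≤ V.unop.len := by omega
    simp only [coneMap, dif_pos hc]
    refine upper_ext f.unop _ hs.symm fun i hi hi' => ?_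
    change (f.unop.toOrderHom ⟨i, hi⟩ : ℕ)
      = (f.unop.toOrderHom ⟨i + lowerCard f.unop.toOrderHom 0, _⟩ : ℕ) - 0
    simp [hs]

/-! ### Gluing simplices along generating simplices and identifying relations -/

/-- The disjoint union of copies of the standard simplex `Δ^d`, indexed by `I`. -/
def copies (I : Type) (d : ℕ) : SSet.{0} where
  obj U := I × (Δ[d] : SSet.{0}).obj U
  map f := TypeCat.ofHom fun x => (x.1, (Δ[d] : SSet.{0}).map f x.2)
  map_id U := by
    refine ConcreteCategory.hom_ext _ _ fun x => ?_
    simp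
  map_comp f g := by
    refine ConcreteCategory.hom_ext _ _ fun x => ?_
    simp

/-- The generating `d`-simplex of the copy of `Δ^d` with index `k`. -/
def copies.gen {I : Type} {d : ℕ} (k : I) : (copies I d) _⦋d⦌ :=
  (k, SSet.stdSimplex.objEquiv.symm (𝟙 _))

/-- The quotient of the simplicial set `A` by the identifications `lhs r = rhs r` of `m`-simplices:
simplices are identified by the equivalence relation generated by `θ^* (lhs r) ~ θ^* (rhs r)`. -/
def glue (A : SSet.{0}) {ι : Type} {m : ℕ} (lhs rhs : ι → A _⦋m⦌) : SSet.{0} where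
  obj U := Quot fun x y : A.obj U =>
    ∃ (r : ι) (θ : U.unop ⟶ ⦋m⦌), x = A.map θ.op (lhs r) ∧ y = A.map θ.op (rhs r)
  map f := TypeCat.ofHom <| Quot.map (A.map f) <| by
    rintro _ _ ⟨r, θ, rfl, rfl⟩
    exact ⟨r, f.unop ≫ θ, by simp, by simp⟩
  map_id U := by
    refine ConcreteCategory.hom_ext _ _ fun x => ?_
    induction x using Quot.ind
    simp [Quot.map]
  map_comp f g := by
    refine ConcreteCategory.hom_ext _ _ fun x => ?_
    induction x using Quot.ind
    simp [Quot.map]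

/-- The projection onto the quotient. -/
def glueProj (A : SSet.{0}) {ι : Type} {m : ℕ} (lhs rhs : ι → A _⦋m⦌) : A ⟶ glue A lhs rhs where
  app U := TypeCat.ofHom (Quot.mk _)
  naturality _ _ _ := rfl

/-! ### The `N`-circle and the circle inequalities -/

/-- The choice of faces `i_k ≠ i'_k` in the identifying relations of the `N`-circle. -/
structure CircleData (N : ℕ) where
  i : Fin N → Fin 2
  i' : Fin N → Fin 2
  ne : ∀ k, i k ≠ i' k

/-- The `N`-circle `C_N`: generated by edges `τ_k`, with the cyclic identifying relations
`d_{i'_k} τ_k = d_{i_{k+1}} τ_{k+1}` (where `k + 1` is `finRotate N k`). -/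
def circle {N : ℕ} (c : CircleData N) : SSet.{0} :=
  glue (copies (Fin N) 1) (m := 0)
    (fun k => (copies (Fin N) 1).δ (c.i' k) (copies.gen k))
    (fun k => (copies (Fin N) 1).δ (c.i (finRotate N k)) (copies.gen (finRotate N k)))

/-- The generating edge `τ_k` of the `N`-circle. -/
def circle.edge {N : ℕ} (c : CircleData N) (k : Fin N) : (circle c) _⦋1⦌ :=
  (glueProj _ _ _).app (op ⦋1⦌) (copies.gen k)

/-- The `N`-circle inequalities. -/
def CircleInequalities {N : ℕ} {c : CircleData N} (p : SDist (circle c) nerveZ2) : Prop :=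
  ∀ a : Fin N → ZMod 2, ∑ k, a k = (N : ZMod 2) + 1 →
    0 ≤ (N : ℝ) - 2 + ∑ k, (-1) ^ (a k).val * expectation p (circle.edge c k)

/-- The `N`-cycle scenario `C̃_N`, the cone on the `N`-circle. -/
abbrev cycle {N : ℕ} (c : CircleData N) : SSet.{0} := cone (circle c)

/-! ### The classical `N`-disk -/

/-- The choice of faces in the identifying relations of the classical `N`-disk, which has `N - 2`
generating triangles. The values `j 0` and `j'` of the last index are not used. -/
structure DiskData (N : ℕ) where
  j : Fin (N - 2) → Fin 3
  j' : Fin (N - 2) → Fin 3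
  ne : ∀ k : Fin (N - 2), 0 < (k : ℕ) → (k : ℕ) + 1 < N - 2 → j k ≠ j' k

/-- The classical `N`-disk `D_N`: generated by triangles `σ_k`, with the identifying relations
`d_{j'_k} σ_k = d_{j_{k+1}} σ_{k+1}` for consecutive indices. -/
def disk {N : ℕ} (D : DiskData N) : SSet.{0} :=
  glue (copies (Fin (N - 2)) 2) (ι := {k : Fin (N - 2) // (k : ℕ) + 1 < N - 2}) (m := 1)
    (fun k => (copies (Fin (N - 2)) 2).δ (D.j' k) (copies.gen k.1))
    (fun k => (copies (Fin (N - 2)) 2).δ (D.j ⟨k + 1, k.2⟩) (copies.gen ⟨k + 1, k.2⟩))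

/-- The generating triangle `σ_k` of the classical `N`-disk. -/
def disk.triangle {N : ℕ} (D : DiskData N) (k : Fin (N - 2)) : (disk D) _⦋2⦌ :=
  (glueProj _ _ _).app (op ⦋2⦌) (copies.gen k)

/-- The face `d_f σ_k` is a boundary edge if it occurs in none of the identifying relations. -/
def DiskData.IsBoundary {N : ℕ} (D : DiskData N) (k : Fin (N - 2)) (f : Fin 3) : Prop :=
  ¬ ((k : ℕ) + 1 < N - 2 ∧ f = D.j' k) ∧ ¬ (0 < (k : ℕ) ∧ f = D.j k)

/-- The boundary `∂D_N`: the simplicial subset generated by the boundary edges. -/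
def diskBoundary {N : ℕ} (D : DiskData N) : (disk D).Subcomplex :=
  ⨆ (k : Fin (N - 2)) (f : Fin 3) (_ : D.IsBoundary k f),
    SSet.Subcomplex.ofSimplex ((disk D).δ f (disk.triangle D k))

/-- The inclusion of `C_N` into `D_N` under an identification of `C_N` with `∂D_N`. -/
def circleToDisk {N : ℕ} {c : CircleData N} {D : DiskData N}
    (e : circle c ≅ (diskBoundary D : SSet.{0})) : circle c ⟶ disk D :=
  e.hom ≫ (diskBoundary D).ι

/-- The space `C̃_N ∪_{C_N} D_N`. -/
abbrev cycleWithDisk {N : ℕ} {c : CircleData N} {D : DiskData N}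
    (e : circle c ≅ (diskBoundary D : SSet.{0})) : SSet.{0} :=
  Limits.pushout (coneBase (circle c)) (circleToDisk e)

end

end SimplicialDist
end

/-! A simplicial map from a cone to `nerveZ2` amounts to a `ZMod 2`-valued function on the vertices
of the base, read off on the edges from the cone point. The outcome on the triangle over `τ_k`
records the values at the two ends of `τ_k`, and the outcome on `τ_k` itself is their difference, so
the expectation of `τ_k` is the correlation of two sign variables. Non-contextuality thus asks for a
joint law of variables around a cycle with prescribed laws of consecutive pairs.

Necessity of the inequalities holds pointwise (`circleInequalities_of_potentials`): a coboundary
sums to zero around the circle, so shifting `a` by it preserves the parity `N + 1`, and `N` elements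
of `ZMod 2` of that total cannot all be `1` (`sum_sgn_nonneg`).

For sufficiency, cut the cycle into a path. The correlation of its end points ranges over an
interval found by eliminating intermediate variables (`corrBounds`). The three-variable theorem
`exists_triple` and gluing over a common marginal (`exists_glued`) turn any admissible law of the
end points into a joint law (`exists_path`). Closing the path means prescribing the diagonal law, of
correlation `1`. Unfolding the recursion (`exists_sum_le_corrBounds`), the circle inequalities are
what puts `1` below the upper bound (`exists_cycle`).

For the disk, triangles glued in a chain impose no obstruction: independent gluing along shared
edges makes every distribution on it a mixture of coboundaries (`disk_exists_potentials`). Hence an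
extension over the disk forces the circle inequalities on its boundary. Conversely, every
deterministic assignment on the cone extends over the disk, by extending its potential from the
boundary vertices. -/

noncomputable section

namespace SimplicialDist

open Convexity

/-! ### Expectations with respect to finitely supported distributions -/

/-- The expectation of a function with respect to a finitely supported distribution. -/
def mean {α : Type} (w : StdSimplex ℝ α) (F : α → ℝ) : ℝ := w.weights.sum fun x r => r * F x

theorem mean_map {α β : Type} (w : StdSimplex ℝ α) (g : α → β) (F : β → ℝ) :
    mean (w.map g) F = mean w (fun x => F (g x)) := by
  simp only [mean, StdSimplex.weights_map]
  exact Finsupp.sum_mapDomain_index (by simp) (by intros; ring)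

theorem mean_eq_sum {α : Type} [Fintype α] (w : StdSimplex ℝ α) (F : α → ℝ) :
    mean w F = ∑ x, w.weights x * F x :=
  Finsupp.sum_fintype _ _ (by simp)

theorem weights_eq_mean {α : Type} [DecidableEq α] (w : StdSimplex ℝ α) (x : α) :
    w.weights x = mean w (fun y => if y = x then 1 else 0) := by
  simp [mean, Finsupp.sum]

/-- Indicator functions recover the weights; with `mean_map`, identities between push-forwards
become identities between means. -/
theorem ext_mean {α : Type} {w w' : StdSimplex ℝ α} (h : ∀ F, mean w F = mean w' F) : w = w' := by
  classical
  ext x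
  rw [weights_eq_mean, weights_eq_mean, h]

theorem mean_one {α : Type} (w : StdSimplex ℝ α) : mean w (fun _ => 1) = 1 := by
  simp [mean]

theorem mean_congr {α : Type} {w : StdSimplex ℝ α} {F G : α → ℝ}
    (h : ∀ x ∈ w.weights.support, F x = G x) : mean w F = mean w G :=
  Finset.sum_congr rfl fun x hx => by simp only [h x hx]

theorem mean_nonneg {α : Type} {w : StdSimplex ℝ α} {F : α → ℝ}
    (h : ∀ x ∈ w.weights.support, 0 ≤ F x) : 0 ≤ mean w F :=
  Finset.sum_nonneg fun x hx => mul_nonneg (w.weights_nonneg x) (h x hx)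

theorem mean_add {α : Type} (w : StdSimplex ℝ α) (F G : α → ℝ) :
    mean w (fun x => F x + G x) = mean w F + mean w G := by
  simp [mean, Finsupp.sum, mul_add, Finset.sum_add_distrib]

theorem mean_const_mul {α : Type} (w : StdSimplex ℝ α) (c : ℝ) (F : α → ℝ) :
    mean w (fun x => c * F x) = c * mean w F := by
  simp only [mean, Finsupp.sum, Finset.mul_sum]
  exact Finset.sum_congr rfl fun _ _ => by ring

theorem mean_sum {α ι : Type} (w : StdSimplex ℝ α) (s : Finset ι) (F : ι → α → ℝ) :
    mean w (fun x => ∑ k ∈ s, F k x) = ∑ k ∈ s, mean w (F k) := by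
  simp only [mean, Finsupp.sum, Finset.mul_sum]
  exact Finset.sum_comm

theorem map_congr_support {α β : Type} {w : StdSimplex ℝ α} {f g : α → β}
    (h : ∀ x ∈ w.weights.support, f x = g x) : w.map f = w.map g :=
  ext_mean fun F => by
    rw [mean_map, mean_map]
    exact mean_congr fun x hx => by rw [h x hx]

/-- Weights are nonnegative, so nothing cancels under push-forward. -/
theorem mem_support_of_map {α β : Type} {w : StdSimplex ℝ α} (g : α → β) {x : α}
    (hx : x ∈ w.weights.support) : g x ∈ (w.map g).weights.support := by
  classical
  have hpos : 0 < w.weights x :=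
    lt_of_le_of_ne (w.weights_nonneg x) (Ne.symm (Finsupp.mem_support_iff.1 hx))
  rw [Finsupp.mem_support_iff, weights_eq_mean, mean_map]
  refine (lt_of_lt_of_le hpos ?_).ne'
  have h := Finset.single_le_sum (s := w.weights.support)
    (f := fun y => w.weights y * (if g y = g x then (1 : ℝ) else 0))
    (fun y _ => mul_nonneg (w.weights_nonneg y) (by split_ifs <;> norm_num)) hx
  simpa [mean, Finsupp.sum] using h

theorem exists_mem_support_of_map {α β : Type} {w : StdSimplex ℝ α} {g : α → β} {y : β}
    (hy : y ∈ (w.map g).weights.support) : ∃ x ∈ w.weights.support, g x = y := by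
  classical
  have := Finsupp.mapDomain_support hy
  simpa using this

/-- The distribution with given nonnegative weights that vanish outside of a finite set. -/
def ofFinset {α : Type} [DecidableEq α] (S : Finset α) (f : α → ℝ) (h0 : ∀ x, 0 ≤ f x)
    (hS : ∀ x, f x ≠ 0 → x ∈ S) (h1 : ∑ x ∈ S, f x = 1) : StdSimplex ℝ α where
  weights := Finsupp.onFinset S f hS
  nonneg := fun x => h0 x
  total := by
    rw [Finsupp.onFinset_sum _ (by simp)]
    exact h1

theorem mean_ofFinset {α : Type} [DecidableEq α] (S : Finset α) (f : α → ℝ) (h0 : ∀ x, 0 ≤ f x)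
    (hS : ∀ x, f x ≠ 0 → x ∈ S) (h1 : ∑ x ∈ S, f x = 1) (F : α → ℝ) :
    mean (ofFinset S f h0 hS h1) F = ∑ x ∈ S, f x * F x :=
  Finsupp.onFinset_sum hS (by simp)

/-- Distributions on `α` and `β` with the same push-forward to `γ` are the marginals of a
distribution which is supported on the fibre product of `α` and `β` over `γ`. -/
theorem exists_glued {α β γ : Type} (w₁ : StdSimplex ℝ α) (w₂ : StdSimplex ℝ β) (f : α → γ)
    (g : β → γ) (h : w₁.map f = w₂.map g) :
    ∃ w : StdSimplex ℝ (α × β), w.map Prod.fst = w₁ ∧ w.map Prod.snd = w₂ ∧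
      ∀ x ∈ w.weights.support, f x.1 = g x.2 := by
  classical
  set m : γ → ℝ := fun c => (w₁.map f).weights c with hm
  have hm1 : ∀ c, m c = ∑ a ∈ w₁.weights.support, if f a = c then w₁.weights a else 0 := fun c => by
    rw [hm]
    simp only
    rw [weights_eq_mean, mean_map]
    simp [mean, Finsupp.sum]
  have hm2 : ∀ c, m c = ∑ b ∈ w₂.weights.support, if g b = c then w₂.weights b else 0 := fun c => by
    rw [hm]
    simp only
    rw [h, weights_eq_mean, mean_map]
    simp [mean, Finsupp.sum]
  have hf : ∀ a ∈ w₁.weights.support, m (f a) ≠ 0 := fun a ha =>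
    Finsupp.mem_support_iff.1 (mem_support_of_map f ha)
  have hg : ∀ b ∈ w₂.weights.support, m (g b) ≠ 0 := fun b hb => by
    rw [hm]
    simp only
    rw [h]
    exact Finsupp.mem_support_iff.1 (mem_support_of_map g hb)
  -- The coupling that is conditionally independent given the common value in `γ`. If `m (f x.1)`
  -- vanishes, so does `w₁.weights x.1`, so division by zero is harmless.
  set W : α × β → ℝ := fun x =>
    if f x.1 = g x.2 then w₁.weights x.1 * w₂.weights x.2 / m (f x.1) else 0 with hW
  have h0 : ∀ x, 0 ≤ W x := fun x => by
    rw [hW]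
    simp only
    split_ifs
    · exact div_nonneg (mul_nonneg (w₁.weights_nonneg _) (w₂.weights_nonneg _))
        ((w₁.map f).weights_nonneg _)
    · exact le_rfl
  have hS : ∀ x, W x ≠ 0 → x ∈ w₁.weights.support ×ˢ w₂.weights.support := fun x hx => by
    rw [Finset.mem_product, Finsupp.mem_support_iff, Finsupp.mem_support_iff]
    constructor <;> intro h' <;> simp [hW, h'] at hx
  have e1 : ∀ F : α → ℝ, ∑ x ∈ w₁.weights.support ×ˢ w₂.weights.support, W x * F x.1 = mean w₁ F := by
    intro F
    rw [Finset.sum_product, mean, Finsupp.sum]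
    refine Finset.sum_congr rfl fun a ha => ?_
    have : ∀ b, W (a, b) * F a
        = (if g b = f a then w₂.weights b else 0) * (w₁.weights a * F a / m (f a)) := fun b => by
      simp only [hW, eq_comm (a := g b)]
      split_ifs <;> ring
    simp only [this]
    rw [← Finset.sum_mul, ← hm2]
    have := hf a ha
    field_simp
  have e2 : ∀ F : β → ℝ, ∑ x ∈ w₁.weights.support ×ˢ w₂.weights.support, W x * F x.2 = mean w₂ F := by
    intro F
    rw [Finset.sum_product_right, mean, Finsupp.sum]
    refine Finset.sum_congr rfl fun b hb => ?_
    have : ∀ a, W (a, b) * F b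
        = (if f a = g b then w₁.weights a else 0) * (w₂.weights b * F b / m (g b)) := fun a => by
      simp only [hW]
      split_ifs with hab
      · rw [hab]; ring
      · ring
    simp only [this]
    rw [← Finset.sum_mul, ← hm1]
    have := hg b hb
    field_simp
  have h1 : ∑ x ∈ w₁.weights.support ×ˢ w₂.weights.support, W x = 1 := by
    have := e1 fun _ => 1
    rw [mean_one] at this
    simpa using this
  refine ⟨ofFinset _ W h0 hS h1, ext_mean fun F => ?_, ext_mean fun F => ?_, fun x hx => ?_⟩
  · rw [mean_map, mean_ofFinset, e1]
  · rw [mean_map, mean_ofFinset, e2]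
  · by_contra hne
    exact Finsupp.mem_support_iff.1 hx (by simp [ofFinset, hW, hne])

/-! ### Pairs and triples of `ℤ₂`-valued variables -/

/-- The character `a ↦ (-1)^a` of `ℤ₂`. -/
def sgn (a : ZMod 2) : ℝ := (-1) ^ a.val

@[simp] theorem sgn_zero : sgn 0 = 1 := by simp [sgn]

@[simp] theorem sgn_one : sgn 1 = -1 := by simp [sgn, ZMod.val_one]

theorem zmod_two_cases (a : ZMod 2) : a = 0 ∨ a = 1 := by
  revert a; decide

theorem sgn_add (a b : ZMod 2) : sgn (a + b) = sgn a * sgn b := by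
  rcases zmod_two_cases a with rfl | rfl <;> rcases zmod_two_cases b with rfl | rfl <;>
    simp [show (1 : ZMod 2) + 1 = 0 from rfl]

theorem sgn_eq_or (a : ZMod 2) : sgn a = 1 ∨ sgn a = -1 := by
  rcases zmod_two_cases a with rfl | rfl <;> simp

theorem sum_zmod_two (F : ZMod 2 → ℝ) : ∑ a, F a = F 0 + F 1 := Fin.sum_univ_two F

/-- The conditions on the moments of a pair of sign-valued random variables. -/
def Compatible (x y u : ℝ) : Prop :=
  0 ≤ 1 + x + y + u ∧ 0 ≤ 1 + x - y - u ∧ 0 ≤ 1 - x + y - u ∧ 0 ≤ 1 - x - y + u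

/-- Fourier inversion on `ZMod 2 × ZMod 2`: two means and a correlation determine the law.
Nonnegativity of the four weights is then exactly `Compatible`. -/
theorem pair_weights (q : StdSimplex ℝ (ZMod 2 × ZMod 2)) (a b : ZMod 2) :
    q.weights (a, b) = (1 + sgn a * mean q (fun z => sgn z.1) + sgn b * mean q (fun z => sgn z.2)
      + sgn a * sgn b * mean q (fun z => sgn z.1 * sgn z.2)) / 4 := by
  have h := mean_one q
  simp only [mean_eq_sum, Fintype.sum_prod_type, sum_zmod_two] at h ⊢
  rcases zmod_two_cases a with rfl | rfl <;> rcases zmod_two_cases b with rfl | rfl <;>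
    simp only [sgn_zero, sgn_one] <;> linarith

theorem pair_ext {q q' : StdSimplex ℝ (ZMod 2 × ZMod 2)}
    (h₁ : mean q (fun z => sgn z.1) = mean q' (fun z => sgn z.1))
    (h₂ : mean q (fun z => sgn z.2) = mean q' (fun z => sgn z.2))
    (h₃ : mean q (fun z => sgn z.1 * sgn z.2) = mean q' (fun z => sgn z.1 * sgn z.2)) : q = q' := by
  ext ⟨a, b⟩
  rw [pair_weights, pair_weights, h₁, h₂, h₃]

theorem zmod_two_ext {r r' : StdSimplex ℝ (ZMod 2)} (h : mean r sgn = mean r' sgn) : r = r' := by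
  have key : ∀ r : StdSimplex ℝ (ZMod 2), ∀ a, r.weights a = (1 + sgn a * mean r sgn) / 2 := by
    intro r a
    have h := mean_one r
    simp only [mean_eq_sum, sum_zmod_two] at h ⊢
    rcases zmod_two_cases a with rfl | rfl <;> simp only [sgn_zero, sgn_one] <;> linarith
  ext a
  rw [key, key, h]

theorem pair_compatible (q : StdSimplex ℝ (ZMod 2 × ZMod 2)) :
    Compatible (mean q fun z => sgn z.1) (mean q fun z => sgn z.2)
      (mean q fun z => sgn z.1 * sgn z.2) := by
  have h : ∀ a b, 0 ≤ q.weights (a, b) := fun a b => q.weights_nonneg _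
  simp only [pair_weights] at h
  have h00 := h 0 0
  have h01 := h 0 1
  have h10 := h 1 0
  have h11 := h 1 1
  simp only [sgn_zero, sgn_one] at h00 h01 h10 h11
  refine ⟨?_, ?_, ?_, ?_⟩ <;> linarith

theorem exists_pair {x y u : ℝ} (h : Compatible x y u) :
    ∃ q : StdSimplex ℝ (ZMod 2 × ZMod 2), mean q (fun z => sgn z.1) = x ∧
      mean q (fun z => sgn z.2) = y ∧ mean q (fun z => sgn z.1 * sgn z.2) = u := by
  obtain ⟨h1, h2, h3, h4⟩ := h
  refine ⟨ofFinset Finset.univ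
    (fun z => (1 + sgn z.1 * x + sgn z.2 * y + sgn z.1 * sgn z.2 * u) / 4) ?_ (by simp) ?_, ?_, ?_, ?_⟩
  · rintro ⟨a, b⟩
    rcases zmod_two_cases a with rfl | rfl <;> rcases zmod_two_cases b with rfl | rfl <;>
      simp only [sgn_zero, sgn_one] <;> linarith
  · simp only [Fintype.sum_prod_type, sum_zmod_two, sgn_zero, sgn_one]; ring
  all_goals
    rw [mean_ofFinset]
    simp only [Fintype.sum_prod_type, sum_zmod_two, sgn_zero, sgn_one]; ring

/-- Fine's theorem for three variables. -/
theorem exists_triple (q₁ q₂ q₃ : StdSimplex ℝ (ZMod 2 × ZMod 2))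
    (h₁₂ : q₁.map Prod.snd = q₂.map Prod.fst) (h₂₃ : q₂.map Prod.snd = q₃.map Prod.snd)
    (h₁₃ : q₁.map Prod.fst = q₃.map Prod.fst)
    (h : Compatible (mean q₁ fun z => sgn z.1 * sgn z.2) (mean q₂ fun z => sgn z.1 * sgn z.2)
      (mean q₃ fun z => sgn z.1 * sgn z.2)) :
    ∃ T : StdSimplex ℝ (ZMod 2 × ZMod 2 × ZMod 2),
      T.map (fun z => (z.1, z.2.1)) = q₁ ∧ T.map (fun z => (z.2.1, z.2.2)) = q₂ ∧
      T.map (fun z => (z.1, z.2.2)) = q₃ := by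
  have c1 := pair_compatible q₁
  have c2 := pair_compatible q₂
  have c3 := pair_compatible q₃
  have e12 : mean q₁ (fun z => sgn z.2) = mean q₂ (fun z => sgn z.1) := by
    rw [← mean_map q₁ Prod.snd sgn, ← mean_map q₂ Prod.fst sgn, h₁₂]
  have e23 : mean q₂ (fun z => sgn z.2) = mean q₃ (fun z => sgn z.2) := by
    rw [← mean_map q₂ Prod.snd sgn, ← mean_map q₃ Prod.snd sgn, h₂₃]
  have e13 : mean q₁ (fun z => sgn z.1) = mean q₃ (fun z => sgn z.1) := by
    rw [← mean_map q₁ Prod.fst sgn, ← mean_map q₃ Prod.fst sgn, h₁₃]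
  rw [← e12] at c2
  rw [← e13, ← e23] at c3
  set x := mean q₁ (fun z => sgn z.1) with hx
  set y := mean q₁ (fun z => sgn z.2) with hy
  set z := mean q₂ (fun z => sgn z.2) with hz
  set u := mean q₁ (fun z => sgn z.1 * sgn z.2) with hu
  set v := mean q₂ (fun z => sgn z.1 * sgn z.2) with hv
  set t := mean q₃ (fun z => sgn z.1 * sgn z.2) with ht
  obtain ⟨a1, a2, a3, a4⟩ := c1
  obtain ⟨b1, b2, b3, b4⟩ := c2
  obtain ⟨d1, d2, d3, d4⟩ := c3
  obtain ⟨g1, g2, g3, g4⟩ := h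
  -- The triple moment `s` is the only free parameter, bounded by nonnegativity of eight weights. Of
  -- the sixteen comparisons of a lower with an upper bound, twelve are nonnegativity of pair
  -- weights and four are the hypothesis `h` on the correlations.
  obtain ⟨s, s1, s2, s3, s4, s5, s6, s7, s8⟩ : ∃ s : ℝ,
      -(1 + x + y + z + u + v + t) ≤ s ∧ -(1 + x - y - z - u + v - t) ≤ s ∧
      -(1 - x + y - z - u - v + t) ≤ s ∧ -(1 - x - y + z + u - v - t) ≤ s ∧
      s ≤ 1 - x - y - z + u + v + t ∧ s ≤ 1 - x + y + z - u + v - t ∧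
      s ≤ 1 + x - y + z - u - v + t ∧ s ≤ 1 + x + y - z + u - v - t := by
    refine ⟨max (max (-(1 + x + y + z + u + v + t)) (-(1 + x - y - z - u + v - t)))
      (max (-(1 - x + y - z - u - v + t)) (-(1 - x - y + z + u - v - t))),
      (le_max_left _ _).trans (le_max_left _ _), (le_max_right _ _).trans (le_max_left _ _),
      (le_max_left _ _).trans (le_max_right _ _), (le_max_right _ _).trans (le_max_right _ _),
      ?_, ?_, ?_, ?_⟩ <;>
    refine max_le (max_le ?_ ?_) (max_le ?_ ?_) <;> linarith
  let f : ZMod 2 × ZMod 2 × ZMod 2 → ℝ := fun w =>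
    (1 + sgn w.1 * x + sgn w.2.1 * y + sgn w.2.2 * z + sgn w.1 * sgn w.2.1 * u
      + sgn w.2.1 * sgn w.2.2 * v + sgn w.1 * sgn w.2.2 * t
      + sgn w.1 * sgn w.2.1 * sgn w.2.2 * s) / 8
  have f0 : ∀ w, 0 ≤ f w := by
    rintro ⟨a, b, c⟩
    simp only [f]
    rcases zmod_two_cases a with rfl | rfl <;> rcases zmod_two_cases b with rfl | rfl <;>
      rcases zmod_two_cases c with rfl | rfl <;> simp only [sgn_zero, sgn_one] <;> linarith
  have f1 : ∑ w, f w = 1 := by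
    simp only [f, Fintype.sum_prod_type, sum_zmod_two, sgn_zero, sgn_one]; ring
  refine ⟨ofFinset Finset.univ f f0 (by simp) f1, pair_ext ?_ ?_ ?_, pair_ext ?_ ?_ ?_,
    pair_ext ?_ ?_ ?_⟩ <;> rw [mean_map, mean_ofFinset] <;>
    simp only [f, ← hx, ← hy, ← hz, ← hu, ← hv, ← ht, ← e12, ← e23, ← e13, Fintype.sum_prod_type,
      sum_zmod_two, sgn_zero, sgn_one] <;> ring

/-! ### Fine's theorem for paths and cycles of `ℤ₂`-valued variables -/

/-- The least and the largest value of the correlation of the end points of a path of `n` edges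
with correlations `u 0, …, u (n - 1)`. -/
def corrBounds (u : ℕ → ℝ) : ℕ → ℝ × ℝ
  | 0 => (1, 1)
  | n + 1 => (max (-1) (max ((corrBounds u n).1 + u n - 1) (-u n - (corrBounds u n).2 - 1)),
      min 1 (min (1 - u n + (corrBounds u n).2) (1 + u n - (corrBounds u n).1)))

/-- The interval is nonempty, lies in `[-1, 1]`, and meets the range `[|x 0 + x n| - 1, 1 - |x 0 - x
n|]` that the means of the end points allow. These facts together are strong enough to carry the
induction, and they supply the comparisons needed in `exists_path`. -/
theorem corrBounds_compatible (u x : ℕ → ℝ) (n : ℕ)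
    (h : ∀ k < n, Compatible (x k) (x (k + 1)) (u k)) (h0 : -1 ≤ x 0 ∧ x 0 ≤ 1) :
    (corrBounds u n).1 ≤ (corrBounds u n).2 ∧ -1 ≤ (corrBounds u n).1 ∧ (corrBounds u n).2 ≤ 1 ∧
      -1 - x 0 - x n ≤ (corrBounds u n).2 ∧ x 0 + x n - 1 ≤ (corrBounds u n).2 ∧
      (corrBounds u n).1 ≤ 1 + x 0 - x n ∧ (corrBounds u n).1 ≤ 1 - x 0 + x n := by
  induction n with
  | zero =>
    simp only [corrBounds]
    refine ⟨?_, ?_, ?_, ?_, ?_, ?_, ?_⟩ <;> linarith [h0.1, h0.2]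
  | succ n ih =>
    obtain ⟨i1, i2, i3, i4, i5, i6, i7⟩ := ih fun k hk => h k (hk.trans n.lt_succ_self)
    obtain ⟨c1, c2, c3, c4⟩ := h n n.lt_succ_self
    obtain ⟨h0, h0'⟩ := h0
    simp only [corrBounds]
    refine ⟨max_le (le_min ?_ (le_min ?_ ?_)) (max_le (le_min ?_ (le_min ?_ ?_))
      (le_min ?_ (le_min ?_ ?_))), le_max_left _ _, min_le_left _ _, le_min ?_ (le_min ?_ ?_),
      le_min ?_ (le_min ?_ ?_), max_le ?_ (max_le ?_ ?_), max_le ?_ (max_le ?_ ?_)⟩ <;> linarith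

/-- Distributions of consecutive pairs with matching marginals, and a distribution of the pair of
end points with an admissible correlation, come from a joint distribution. -/
theorem exists_path (q : ℕ → StdSimplex ℝ (ZMod 2 × ZMod 2))
    (hq : ∀ k, (q k).map Prod.snd = (q (k + 1)).map Prod.fst) (n : ℕ)
    (Q : StdSimplex ℝ (ZMod 2 × ZMod 2)) (hQ₁ : Q.map Prod.fst = (q 0).map Prod.fst)
    (hQ₂ : Q.map Prod.snd = (q n).map Prod.fst)
    (hL : (corrBounds (fun k => mean (q k) fun z => sgn z.1 * sgn z.2) n).1
      ≤ mean Q fun z => sgn z.1 * sgn z.2)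
    (hU : mean Q (fun z => sgn z.1 * sgn z.2)
      ≤ (corrBounds (fun k => mean (q k) fun z => sgn z.1 * sgn z.2) n).2) :
    ∃ W : StdSimplex ℝ (ℕ → ZMod 2), (∀ k < n, W.map (fun x => (x k, x (k + 1))) = q k) ∧
      W.map (fun x => (x 0, x n)) = Q := by
  have hmean : ∀ {w w' : StdSimplex ℝ (ZMod 2 × ZMod 2)} {f g : ZMod 2 × ZMod 2 → ZMod 2},
      w.map f = w'.map g → mean w (fun z => sgn (f z)) = mean w' fun z => sgn (g z) := by
    intro w w' f g h
    rw [← mean_map w f sgn, ← mean_map w' g sgn, h]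
  induction n generalizing Q with
  | zero =>
    refine ⟨(Q.map Prod.fst).map fun a _ => a, by simp, ?_⟩
    rw [StdSimplex.map_map, StdSimplex.map_map]
    -- Both bounds are `1` for the empty path, so `Q` is concentrated on the diagonal and a constant
    -- sequence realizes it.
    have h1 : mean Q (fun z => sgn z.1 * sgn z.2) = 1 := le_antisymm hU hL
    have h2 := hmean (hQ₁.trans hQ₂.symm)
    refine pair_ext ?_ ?_ ?_ <;> simp only [mean_map]
    · exact h2
    · rw [h1, ← mean_one Q]
      exact mean_congr fun z _ => by rcases sgn_eq_or z.1 with h | h <;> simp [h]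
  | succ n ih =>
    set u : ℕ → ℝ := fun k => mean (q k) fun z => sgn z.1 * sgn z.2 with hu
    set x : ℕ → ℝ := fun k => mean (q k) fun z => sgn z.1 with hx
    have hc : ∀ k, Compatible (x k) (x (k + 1)) (u k) := fun k => by
      have := pair_compatible (q k)
      rwa [hmean (hq k)] at this
    have hx0 : -1 ≤ x 0 ∧ x 0 ≤ 1 := by
      obtain ⟨h1, h2, h3, h4⟩ := hc 0
      constructor <;> linarith
    obtain ⟨i1, i2, i3, i4, i5, i6, i7⟩ := corrBounds_compatible u x n (fun k _ => hc k) hx0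
    obtain ⟨c1, c2, c3, c4⟩ := hc n
    have hcQ := pair_compatible Q
    rw [hmean hQ₁, hmean hQ₂] at hcQ
    obtain ⟨d1, d2, d3, d4⟩ := hcQ
    set t := mean Q fun z => sgn z.1 * sgn z.2 with ht
    change 0 ≤ 1 + x 0 + x (n + 1) + t at d1
    change 0 ≤ 1 + x 0 - x (n + 1) - t at d2
    change 0 ≤ 1 - x 0 + x (n + 1) - t at d3
    change 0 ≤ 1 - x 0 - x (n + 1) + t at d4
    simp only [corrBounds, max_le_iff, le_min_iff] at hL hU
    obtain ⟨l1, l2, l3⟩ := hL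
    obtain ⟨m1, m2, m3⟩ := hU
    -- `s` is the intended correlation of the variables `0` and `n`: admissible for the shorter
    -- path, compatible with their means, and compatible with `u n` and `t`. Every lower bound lies
    -- below every upper bound.
    obtain ⟨s, s1, s2, s3, s4, s5, s6, s7, s8, s9, s10⟩ : ∃ s : ℝ,
        (corrBounds u n).1 ≤ s ∧ -1 - x 0 - x n ≤ s ∧ x 0 + x n - 1 ≤ s ∧ -1 - u n - t ≤ s ∧
        u n + t - 1 ≤ s ∧ s ≤ (corrBounds u n).2 ∧ s ≤ 1 + x 0 - x n ∧ s ≤ 1 - x 0 + x n ∧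
        s ≤ 1 + u n - t ∧ s ≤ 1 - u n + t := by
      refine ⟨max (corrBounds u n).1 (max (max (-1 - x 0 - x n) (x 0 + x n - 1))
        (max (-1 - u n - t) (u n + t - 1))), le_max_left _ _,
        ((le_max_left _ _).trans (le_max_left _ _)).trans (le_max_right _ _),
        ((le_max_right _ _).trans (le_max_left _ _)).trans (le_max_right _ _),
        ((le_max_left _ _).trans (le_max_right _ _)).trans (le_max_right _ _),
        ((le_max_right _ _).trans (le_max_right _ _)).trans (le_max_right _ _), ?_, ?_, ?_, ?_, ?_⟩
        <;> refine max_le ?_ (max_le (max_le ?_ ?_) (max_le ?_ ?_)) <;> linarith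
    obtain ⟨Q', e1, e2, e3⟩ : ∃ Q' : StdSimplex ℝ (ZMod 2 × ZMod 2),
        mean Q' (fun z => sgn z.1) = x 0 ∧ mean Q' (fun z => sgn z.2) = x n ∧
        mean Q' (fun z => sgn z.1 * sgn z.2) = s :=
      exists_pair ⟨by linarith, by linarith, by linarith, by linarith⟩
    have f1 : Q'.map Prod.fst = (q 0).map Prod.fst := zmod_two_ext (by simp only [mean_map, e1, hx])
    have f2 : Q'.map Prod.snd = (q n).map Prod.fst := zmod_two_ext (by simp only [mean_map, e2, hx])
    obtain ⟨W, hW1, hW2⟩ := ih Q' f1 f2 (by rw [e3]; exact s1) (by rw [e3]; exact s6)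
    obtain ⟨T, hT1, hT2, hT3⟩ := exists_triple Q' (q n) Q f2 ((hq n).trans hQ₂.symm)
      (f1.trans hQ₁.symm) (by
        rw [e3]
        change Compatible s (u n) t
        exact ⟨by linarith, by linarith, by linarith, by linarith⟩)
    -- The shorter path and the triangle on the variables `0`, `n`, `n + 1` share the pair `(0, n)`;
    -- the last entry of the triple becomes the new variable.
    obtain ⟨R, hR1, hR2, hR3⟩ := exists_glued W T (fun x => (x 0, x n)) (fun z => (z.1, z.2.1))
      (hW2.trans hT1.symm)
    have hR3' : ∀ z ∈ R.weights.support, z.1 0 = z.2.1 ∧ z.1 n = z.2.2.1 := fun z hz => by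
      simpa using hR3 z hz
    refine ⟨R.map fun z => Function.update z.1 (n + 1) z.2.2.2, fun k hk => ?_, ?_⟩
    · rw [StdSimplex.map_map]
      rcases Nat.lt_succ_iff_lt_or_eq.1 hk with hk | rfl
      · rw [← hW1 k hk, ← hR1, StdSimplex.map_map]
        refine map_congr_support fun z _ => ?_
        rw [Function.update_of_ne (by omega), Function.update_of_ne (by omega)]
      · rw [← hT2, ← hR2, StdSimplex.map_map]
        refine map_congr_support fun z hz => ?_
        rw [Function.update_of_ne (by omega), Function.update_self, (hR3' z hz).2]
    · rw [StdSimplex.map_map, ← hT3, ← hR2, StdSimplex.map_map]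
      refine map_congr_support fun z hz => ?_
      rw [Function.update_of_ne (by omega), Function.update_self, (hR3' z hz).1]

theorem zmod_two_double (a : ZMod 2) : a + a = 0 := by
  revert a; decide

/-- Each `min` or `max` in the recursion selects a branch, and a branch either appends a sign or
resets to the trivial bound. The parity of the signs distinguishes upper from lower bounds. -/
theorem exists_sum_le_corrBounds (u : ℕ → ℝ) (hu : ∀ k, -1 ≤ u k ∧ u k ≤ 1) (n : ℕ) :
    (1 ≤ (corrBounds u n).2 ∨ ∃ a : ℕ → ZMod 2, ∑ k ∈ Finset.range n, a k = n + 1 ∧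
      (n : ℝ) - 1 + ∑ k ∈ Finset.range n, sgn (a k) * u k ≤ (corrBounds u n).2) ∧
    ((corrBounds u n).1 ≤ -1 ∨ ∃ a : ℕ → ZMod 2, ∑ k ∈ Finset.range n, a k = n ∧
      (corrBounds u n).1 ≤ 1 - (n : ℝ) - ∑ k ∈ Finset.range n, sgn (a k) * u k) := by
  induction n with
  | zero => exact ⟨Or.inl le_rfl, Or.inr ⟨0, by simp, by simp [corrBounds]⟩⟩
  | succ n ih =>
    have hext : ∀ (a : ℕ → ZMod 2) (b : ZMod 2),
        ∑ k ∈ Finset.range (n + 1), Function.update a n b k = ∑ k ∈ Finset.range n, a k + b ∧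
        ∑ k ∈ Finset.range (n + 1), sgn (Function.update a n b k) * u k
          = ∑ k ∈ Finset.range n, sgn (a k) * u k + sgn b * u n := by
      intro a b
      rw [Finset.sum_range_succ, Finset.sum_range_succ, Function.update_self]
      constructor <;> congr 1 <;> refine Finset.sum_congr rfl fun k hk => ?_ <;>
        rw [Function.update_of_ne (Finset.mem_range.1 hk).ne]
    have h2 : (1 : ZMod 2) + 1 = 0 := rfl
    obtain ⟨hU, hL⟩ := ih
    obtain ⟨hu1, hu2⟩ := hu n
    -- With `A` equal to the upper bound or to minus the lower bound, and `b` the new sign, this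
    -- covers all four nontrivial branches. A trivial bound stays trivial because `|u n| ≤ 1`.
    have key : ∀ (A : ℝ) (b : ZMod 2) (c : ZMod 2), (1 ≤ A ∨ ∃ a : ℕ → ZMod 2,
        ∑ k ∈ Finset.range n, a k = c ∧ (n : ℝ) - 1 + ∑ k ∈ Finset.range n, sgn (a k) * u k ≤ A) →
        1 ≤ 1 + sgn b * u n + A ∨ ∃ a : ℕ → ZMod 2, ∑ k ∈ Finset.range (n + 1), a k = c + b ∧
          ((n + 1 : ℕ) : ℝ) - 1 + ∑ k ∈ Finset.range (n + 1), sgn (a k) * u k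
            ≤ 1 + sgn b * u n + A := by
      rintro A b c (h | ⟨a, ha, h⟩)
      · left
        rcases sgn_eq_or b with hb | hb <;> rw [hb] <;> linarith
      · refine Or.inr ⟨Function.update a n b, by rw [(hext a b).1, ha], ?_⟩
        rw [(hext a b).2]
        push_cast
        linarith
    have hL' : 1 ≤ -(corrBounds u n).1 ∨ ∃ a : ℕ → ZMod 2, ∑ k ∈ Finset.range n, a k = n ∧
        (n : ℝ) - 1 + ∑ k ∈ Finset.range n, sgn (a k) * u k ≤ -(corrBounds u n).1 := by
      rcases hL with h | ⟨a, ha, h⟩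
      · exact Or.inl (by linarith)
      · exact Or.inr ⟨a, ha, by linarith⟩
    have k1 := key _ 1 _ hU
    have k2 := key _ 0 _ hL'
    have k3 := key _ 0 _ hU
    have k4 := key _ 1 _ hL'
    simp only [sgn_zero, sgn_one, add_assoc, h2, add_zero] at k1 k2 k3 k4
    simp only [corrBounds, Nat.cast_add, Nat.cast_one, add_assoc, h2, add_zero] at k1 k2 k3 k4 ⊢
    constructor
    · rcases min_choice 1 (min (1 - u n + (corrBounds u n).2) (1 + u n - (corrBounds u n).1))
        with h | h <;> rw [h]
      · exact Or.inl le_rfl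
      rcases min_choice (1 - u n + (corrBounds u n).2) (1 + u n - (corrBounds u n).1)
        with h | h <;> rw [h]
      · rcases k1 with h | ⟨a, ha, h⟩
        · exact Or.inl (by linarith)
        · exact Or.inr ⟨a, ha, by linarith⟩
      · rcases k2 with h | ⟨a, ha, h⟩
        · exact Or.inl (by linarith)
        · exact Or.inr ⟨a, ha, by linarith⟩
    · rcases max_choice (-1) (max ((corrBounds u n).1 + u n - 1) (-u n - (corrBounds u n).2 - 1))
        with h | h <;> rw [h]
      · exact Or.inl le_rfl
      rcases max_choice ((corrBounds u n).1 + u n - 1) (-u n - (corrBounds u n).2 - 1)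
        with h | h <;> rw [h]
      · rcases k4 with h | ⟨a, ha, h⟩
        · exact Or.inl (by linarith)
        · exact Or.inr ⟨a, ha, by linarith⟩
      · rcases k3 with h | ⟨a, ha, h⟩
        · exact Or.inl (by linarith)
        · exact Or.inr ⟨a, ha, by linarith⟩

/-- Fine's theorem for cycles of `ℤ₂`-valued variables. -/
theorem exists_cycle (q : ℕ → StdSimplex ℝ (ZMod 2 × ZMod 2))
    (hq : ∀ k, (q k).map Prod.snd = (q (k + 1)).map Prod.fst) (N : ℕ)
    (hN : (q N).map Prod.fst = (q 0).map Prod.fst)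
    (h : ∀ a : ℕ → ZMod 2, ∑ k ∈ Finset.range N, a k = N + 1 →
      0 ≤ (N : ℝ) - 2 + ∑ k ∈ Finset.range N, sgn (a k) * mean (q k) fun z => sgn z.1 * sgn z.2) :
    ∃ W : StdSimplex ℝ (ℕ → ZMod 2), (∀ k < N, W.map (fun x => (x k, x (k + 1))) = q k) ∧
      ∀ x ∈ W.weights.support, x N = x 0 := by
  set u : ℕ → ℝ := fun k => mean (q k) fun z => sgn z.1 * sgn z.2 with hu
  have hu1 : ∀ k, -1 ≤ u k ∧ u k ≤ 1 := fun k => by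
    obtain ⟨h1, h2, h3, h4⟩ := pair_compatible (q k)
    constructor <;> simp only [hu] <;> linarith
  have hU : 1 ≤ (corrBounds u N).2 := by
    rcases (exists_sum_le_corrBounds u hu1 N).1 with h' | ⟨a, ha, h'⟩
    · exact h'
    · have := h a ha
      linarith
  have hL : (corrBounds u N).1 ≤ 1 := by
    cases N with
    | zero => exact le_rfl
    | succ n =>
      have hc : ∀ k, Compatible (mean (q k) fun z => sgn z.1) (mean (q (k + 1)) fun z => sgn z.1)
          (u k) := fun k => by
        have := pair_compatible (q k)
        rwa [← mean_map (q k) Prod.snd sgn, hq k, mean_map] at this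
      have hx0 : -1 ≤ mean (q 0) (fun z => sgn z.1) ∧ mean (q 0) (fun z => sgn z.1) ≤ 1 := by
        obtain ⟨h1, h2, h3, h4⟩ := hc 0
        constructor <;> linarith
      have := corrBounds_compatible u (fun k => mean (q k) fun z => sgn z.1) (n + 1)
        (fun k _ => hc k) hx0
      exact this.1.trans this.2.2.1
  -- The end points are given the diagonal law, which forces `x N = x 0` on the support.
  have h1 : mean ((q 0).map fun z => (z.1, z.1)) (fun z => sgn z.1 * sgn z.2) = 1 := by
    rw [mean_map, ← mean_one (q 0)]
    exact mean_congr fun z _ => by rcases sgn_eq_or z.1 with h | h <;> simp [h]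
  obtain ⟨W, hW1, hW2⟩ := exists_path q hq N ((q 0).map fun z => (z.1, z.1))
    (by rw [StdSimplex.map_map]) (by rw [StdSimplex.map_map, hN]) (by rwa [h1]) (by rwa [h1])
  refine ⟨W, hW1, fun x hx => ?_⟩
  have hx' := mem_support_of_map (fun x => (x 0, x N)) hx
  rw [hW2] at hx'
  obtain ⟨z, -, hz⟩ := exists_mem_support_of_map hx'
  simp only [Prod.mk.injEq] at hz
  rw [← hz.1, ← hz.2]

/-- Distributions with matching push-forwards along a chain come from a joint distribution which is
supported on the matching sequences. -/
theorem exists_chain {T E : Type} (p : ℕ → StdSimplex ℝ T) (r l : ℕ → T → E) (n : ℕ)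
    (h : ∀ k < n, (p k).map (r k) = (p (k + 1)).map (l k)) :
    ∃ W : StdSimplex ℝ (ℕ → T), (∀ k ≤ n, W.map (fun x => x k) = p k) ∧
      ∀ x ∈ W.weights.support, ∀ k < n, r k (x k) = l k (x (k + 1)) := by
  induction n with
  | zero =>
    refine ⟨(p 0).map fun t _ => t, fun k hk => ?_, by simp⟩
    obtain rfl : k = 0 := by omega
    rw [StdSimplex.map_map]
    exact StdSimplex.map_id _
  | succ n ih =>
    obtain ⟨W, hW1, hW2⟩ := ih fun k hk => h k (by omega)
    obtain ⟨R, hR1, hR2, hR3⟩ := exists_glued W (p (n + 1)) (fun x => r n (x n)) (l n) (by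
      rw [← h n n.lt_succ_self, ← hW1 n le_rfl, StdSimplex.map_map])
    refine ⟨R.map fun z => Function.update z.1 (n + 1) z.2, fun k hk => ?_, fun x hx k hk => ?_⟩
    · rw [StdSimplex.map_map]
      rcases Nat.le_succ_iff.1 hk with hk | rfl
      · rw [← hW1 k hk, ← hR1, StdSimplex.map_map]
        refine map_congr_support fun z _ => ?_
        rw [Function.update_of_ne (by omega)]
      · simpa using hR2
    · obtain ⟨z, hz, rfl⟩ := exists_mem_support_of_map hx
      rcases Nat.lt_succ_iff_lt_or_eq.1 hk with hk | rfl
      · rw [Function.update_of_ne (by omega), Function.update_of_ne (by omega)]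
        exact hW2 z.1 (hR1 ▸ mem_support_of_map Prod.fst hz) k hk
      · rw [Function.update_of_ne (by omega), Function.update_self]
        exact hR3 z hz

open scoped Simplicial


/-! ### Outcome assignments and distributions on individual simplices -/

/-- The outcome that `s` assigns to an `n`-simplex. -/
def outcome {Y : SSet.{0}} (s : Y ⟶ nerveZ2) {n : ℕ} (y : Y _⦋n⦌) : Fin n → ZMod 2 :=
  s.app (op ⦋n⦌) y

/-- The distribution of outcomes that `p` assigns to an `n`-simplex. -/
def dist {Y : SSet.{0}} (p : SDist Y nerveZ2) {n : ℕ} (y : Y _⦋n⦌) :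
    StdSimplex ℝ (Fin n → ZMod 2) :=
  p.app (op ⦋n⦌) y

theorem outcome_map {Y : SSet.{0}} (s : Y ⟶ nerveZ2) {m n : ℕ} (θ : ⦋m⦌ ⟶ ⦋n⦌) (y : Y _⦋n⦌) :
    outcome s (Y.map θ.op y) = nerveMap θ.toOrderHom (outcome s y) :=
  NatTrans.naturality_apply s θ.op y

theorem dist_map {Y : SSet.{0}} (p : SDist Y nerveZ2) {m n : ℕ} (θ : ⦋m⦌ ⟶ ⦋n⦌) (y : Y _⦋n⦌) :
    dist p (Y.map θ.op y) = (dist p y).map (nerveMap θ.toOrderHom) :=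
  NatTrans.naturality_apply p θ.op y

theorem dist_ext {Y : SSet.{0}} {p p' : SDist Y nerveZ2}
    (h : ∀ (n : ℕ) (y : Y _⦋n⦌), dist p y = dist p' y) : p = p' := by
  refine NatTrans.ext (funext fun U => ConcreteCategory.hom_ext _ _ fun y => ?_)
  exact h U.unop.len y

theorem dist_Theta {Y : SSet.{0}} (d : StdSimplex ℝ (Y ⟶ nerveZ2)) {n : ℕ} (y : Y _⦋n⦌) :
    dist (Theta d) y = d.map fun s => outcome s y := rfl

theorem dist_comp {X Y : SSet.{0}} (f : X ⟶ Y) (p : SDist Y nerveZ2) {n : ℕ} (x : X _⦋n⦌) :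
    dist (f ≫ p) x = dist p (f.app (op ⦋n⦌) x) := rfl

theorem expectation_eq_mean {Y : SSet.{0}} (p : SDist Y nerveZ2) (e : Y _⦋1⦌) :
    expectation p e = mean (dist p e) fun a => sgn (a 0) := by
  change (dist p e).weights (fun _ => 0) - (dist p e).weights (fun _ => 1) = _
  rw [mean_eq_sum, ← (Equiv.funUnique (Fin 1) (ZMod 2)).symm.sum_comp, sum_zmod_two]
  change _ = (dist p e).weights (fun _ => 0) * sgn 0 + (dist p e).weights (fun _ => 1) * sgn 1
  rw [sgn_zero, sgn_one]
  ring

/-! ### Coboundaries -/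

/-- The `t`-th vertex of a simplex. -/
def vertex {Y : SSet.{0}} {n : ℕ} (y : Y _⦋n⦌) (t : Fin (n + 1)) : Y _⦋0⦌ :=
  Y.map (SimplexCategory.const ⦋0⦌ ⦋n⦌ t).op y

theorem vertex_map {Y : SSet.{0}} {m n : ℕ} (θ : ⦋m⦌ ⟶ ⦋n⦌) (y : Y _⦋n⦌) (t : Fin (m + 1)) :
    vertex (Y.map θ.op y) t = vertex y (θ.toOrderHom t) := by
  rw [vertex, vertex, ← SimplexCategory.const_comp (⦋0⦌) θ t, op_comp, Functor.map_comp_apply]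

theorem map_eq_vertex {Y : SSet.{0}} {n : ℕ} (θ : ⦋0⦌ ⟶ ⦋n⦌) (y : Y _⦋n⦌) :
    Y.map θ.op y = vertex y (θ.toOrderHom 0) := by
  rw [vertex, ← SimplexCategory.eq_const_of_zero θ]

theorem vertex_vertex {Y : SSet.{0}} {n : ℕ} (y : Y _⦋n⦌) (t : Fin (n + 1)) (i : Fin 1) :
    vertex (vertex y t) i = vertex y t :=
  vertex_map (SimplexCategory.const ⦋0⦌ ⦋n⦌ t) y i

theorem vertex_app {X Y : SSet.{0}} (f : X ⟶ Y) {n : ℕ} (x : X _⦋n⦌) (t : Fin (n + 1)) :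
    vertex (f.app (op ⦋n⦌) x) t = f.app (op ⦋0⦌) (vertex x t) :=
  (NatTrans.naturality_apply f _ x).symm

/-- The differences of consecutive values. -/
def diff {n : ℕ} (h : Fin (n + 1) → ZMod 2) (i : Fin n) : ZMod 2 := h i.succ - h i.castSucc

theorem partialSum_zero {n : ℕ} (a : Fin n → ZMod 2) : partialSum a 0 = 0 := by
  simp [partialSum]

theorem partialSum_diff {n : ℕ} (h : Fin (n + 1) → ZMod 2) (t : Fin (n + 1)) :
    partialSum (diff h) t = h t - h 0 := by
  induction t using Fin.induction with
  | zero => simp [partialSum]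
  | succ t ih => rw [partialSum_succ, ih, diff]; ring

theorem partialSum_injective {n : ℕ} : Function.Injective (partialSum : (Fin n → ZMod 2) → _) := by
  intro a b h
  funext i
  have h1 := partialSum_succ a i
  rw [h, partialSum_succ b i] at h1
  exact (add_left_cancel h1).symm

theorem nerveMap_diff {m n : ℕ} (θ : Fin (m + 1) →o Fin (n + 1)) (h : Fin (n + 1) → ZMod 2) :
    nerveMap θ (diff h) = diff fun t => h (θ t) := by
  funext i
  rw [nerveMap_eq, partialSum_diff, partialSum_diff, diff]
  ring

/-- The simplicial map to the nerve of `ℤ₂` with a given potential. -/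
def coboundary {Y : SSet.{0}} (g : Y _⦋0⦌ → ZMod 2) : Y ⟶ nerveZ2 where
  app U := TypeCat.ofHom fun y =>
    (diff fun t => g (vertex (n := U.unop.len) y t) : Fin U.unop.len → ZMod 2)
  naturality U V f := by
    refine ConcreteCategory.hom_ext _ _ fun y => ?_
    change (diff fun t => g (vertex (n := V.unop.len) (Y.map f y) t))
      = nerveMap f.unop.toOrderHom (diff fun t => g (vertex (n := U.unop.len) y t))
    rw [nerveMap_diff]
    congr 1
    funext t
    exact congrArg g (vertex_map (m := V.unop.len) (n := U.unop.len) f.unop y t)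

theorem outcome_coboundary {Y : SSet.{0}} (g : Y _⦋0⦌ → ZMod 2) {n : ℕ} (y : Y _⦋n⦌) :
    outcome (coboundary g) y = diff fun t => g (vertex y t) := rfl

/-! ### Simplices of the cone -/

/-- The monotone map that sends the first `s` elements to the least element, and the others to the
last `k + 1` elements by means of `f`. -/
def joinHom {s l n k : ℕ} (h : s + l = n) (f : Fin (l + 1) →o Fin (k + 1)) :
    Fin (n + 1) →o Fin (k + 1 + 1) where
  toFun i := if hi : (i : ℕ) < s then 0 else (f ⟨i - s, by omega⟩).succ
  monotone' i j hij := by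
    have hij' : (i : ℕ) ≤ j := hij
    dsimp only
    split_ifs with h1 h2 h2
    · exact le_rfl
    · exact Fin.zero_le _
    · omega
    · exact Fin.succ_le_succ_iff.2 (f.monotone (Nat.sub_le_sub_right hij' s))

theorem joinHom_add {s l n k : ℕ} (h : s + l = n) (f : Fin (l + 1) →o Fin (k + 1)) (i : ℕ)
    (hi : i < l + 1) : joinHom h f ⟨i + s, by omega⟩ = (f ⟨i, hi⟩).succ := by
  change (if hi : i + s < s then 0 else (f ⟨i + s - s, by omega⟩).succ : Fin (k + 1 + 1)) = _
  rw [dif_neg (by omega)]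
  simp

/-- The simplicial operator given by `joinHom`. -/
def joinMap {s l n k : ℕ} (h : s + l = n) (f : ⦋l⦌ ⟶ ⦋k⦌) : ⦋n⦌ ⟶ ⦋k + 1⦌ :=
  SimplexCategory.mkHom (joinHom h f.toOrderHom)

/-- The simplex of the cone on `X` that is spanned by the cone point and the simplex `x`. -/
def coneOn {X : SSet.{0}} {k : ℕ} (x : X _⦋k⦌) : (cone X) _⦋k + 1⦌ :=
  ConeSimplex.upper 1 k (Nat.add_comm 1 k) x

/-- Shows that the simplices `coneOn x` generate the cone apart from the apex. The case `s = 0`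
gives the base, and `s = 1`, `l = 0` the edges from the cone point. -/
theorem map_joinMap_coneOn {X : SSet.{0}} {s l n k : ℕ} (h : s + l = n) (f : ⦋l⦌ ⟶ ⦋k⦌)
    (x : X _⦋k⦌) : (cone X).map (joinMap h f).op (coneOn x) = ConeSimplex.upper s l h (X.map f.op x) := by
  change coneMap X (joinHom h f.toOrderHom) (ConeSimplex.upper 1 k (Nat.add_comm 1 k) x) = _
  have hval : ∀ i : Fin (n + 1), (joinHom h f.toOrderHom i : ℕ) < 1 ↔ (i : ℕ) < s := fun i => by
    simp only [joinHom, OrderHom.coe_mk]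
    split_ifs with hi <;> simp [hi]
  have hs : lowerCard (joinHom h f.toOrderHom) 1 = s := by
    rw [lowerCard]
    simp only [hval]
    rw [Fin.card_filter_val_lt]
    omega
  have hc : lowerCard (joinHom h f.toOrderHom) 1 ≤ n := by omega
  rw [coneMap, dif_pos hc]
  refine upper_ext _ _ hs fun i hi hi' => ?_
  change (joinHom h f.toOrderHom ⟨i + lowerCard (joinHom h f.toOrderHom) 1, _⟩ : ℕ) - 1 = _
  have e : (⟨i + lowerCard (joinHom h f.toOrderHom) 1, by omega⟩ : Fin (n + 1))
      = ⟨i + s, by omega⟩ := by simp [hs]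
  rw [e, joinHom_add h f.toOrderHom i hi']
  simp

theorem map_const_coneOn {X : SSet.{0}} {n k : ℕ} (x : X _⦋k⦌) :
    (cone X).map (SimplexCategory.const ⦋n⦌ ⦋k + 1⦌ 0).op (coneOn x) = ConeSimplex.apex := by
  change coneMap X (OrderHom.const (Fin (n + 1)) (0 : Fin (k + 1 + 1)))
    (ConeSimplex.upper 1 k (Nat.add_comm 1 k) x) = _
  have hs : lowerCard (OrderHom.const (Fin (n + 1)) (0 : Fin (k + 1 + 1))) 1 = n + 1 := by
    simp [lowerCard]
  rw [coneMap, dif_neg (by omega)]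

/-- Vertex `0` of `coneOn x` is the cone point and vertex `t.succ` is vertex `t` of `x`; the partial
sum adds the outcomes along the path between them. -/
theorem outcome_coneOn_vertex {X : SSet.{0}} (s : cone X ⟶ nerveZ2) {n : ℕ} (x : X _⦋n⦌)
    (t : Fin (n + 1)) : outcome s (coneOn (vertex x t)) 0 = partialSum (outcome s (coneOn x)) t.succ := by
  have h := map_joinMap_coneOn (s := 1) (l := 0) rfl (SimplexCategory.const ⦋0⦌ ⦋n⦌ t) x
  change _ = coneOn (vertex x t) at h
  rw [← h, outcome_map, nerveMap_eq]
  change partialSum _ t.succ - partialSum _ 0 = _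
  rw [partialSum_zero, sub_zero]

/-- On the base, an assignment is the coboundary of its values on the edges from the cone point. -/
theorem outcome_coneBase {X : SSet.{0}} (s : cone X ⟶ nerveZ2) {n : ℕ} (x : X _⦋n⦌) :
    outcome (coneBase X ≫ s) x = diff fun t => outcome s (coneOn (vertex x t)) 0 := by
  have h := map_joinMap_coneOn (s := 0) (Nat.zero_add n) (𝟙 ⦋n⦌) x
  simp only [op_id, Functor.map_id_apply] at h
  change outcome s (ConeSimplex.upper 0 n (Nat.zero_add n) x : (cone X) _⦋n⦌) = _
  funext i
  rw [← h, outcome_map, nerveMap_eq, diff, outcome_coneOn_vertex, outcome_coneOn_vertex]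
  rfl

theorem dist_coneOn_vertex {X : SSet.{0}} (p : SDist (cone X) nerveZ2) {n : ℕ} (x : X _⦋n⦌)
    (t : Fin (n + 1)) : (dist p (coneOn (vertex x t))).map (fun a => a 0)
      = (dist p (coneOn x)).map fun a => partialSum a t.succ := by
  have h := map_joinMap_coneOn (s := 1) (l := 0) rfl (SimplexCategory.const ⦋0⦌ ⦋n⦌ t) x
  change _ = coneOn (vertex x t) at h
  rw [← h, dist_map, StdSimplex.map_map]
  congr 1
  funext a
  rw [nerveMap_eq]
  change partialSum _ t.succ - partialSum _ 0 = _
  rw [partialSum_zero, sub_zero]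

theorem dist_coneBase {X : SSet.{0}} (p : SDist (cone X) nerveZ2) {n : ℕ} (x : X _⦋n⦌) :
    dist (coneBase X ≫ p) x
      = (dist p (coneOn x)).map fun a => diff fun t => partialSum a t.succ := by
  have h := map_joinMap_coneOn (s := 0) (Nat.zero_add n) (𝟙 ⦋n⦌) x
  simp only [op_id, Functor.map_id_apply] at h
  change dist p (ConeSimplex.upper 0 n (Nat.zero_add n) x : (cone X) _⦋n⦌) = _
  rw [← h, dist_map]
  congr 1
  funext a i
  rw [nerveMap_eq, diff]
  rfl

/-- The extension of a potential to the cone by zero on the cone point. -/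
def conePotential {X : SSet.{0}} (g : X _⦋0⦌ → ZMod 2) : (cone X) _⦋0⦌ → ZMod 2 := fun v =>
  match (v : ConeSimplex X 0) with
  | ConeSimplex.apex => 0
  | ConeSimplex.upper _ _ _ x => g (vertex x 0)

theorem partialSum_outcome_conePotential {X : SSet.{0}} (g : X _⦋0⦌ → ZMod 2) {n : ℕ} (x : X _⦋n⦌)
    (t : Fin (n + 1)) :
    partialSum (outcome (coboundary (conePotential g)) (coneOn x)) t.succ = g (vertex x t) := by
  rw [← outcome_coneOn_vertex, outcome_coboundary, diff]
  have h0 : vertex (coneOn (vertex x t)) 0 = ConeSimplex.apex := map_const_coneOn _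
  have h1 : vertex (coneOn (vertex x t)) 1
      = ConeSimplex.upper 0 0 rfl ((X.map (𝟙 ⦋0⦌ : ⦋0⦌ ⟶ ⦋0⦌).op (vertex x t))) := by
    rw [← map_joinMap_coneOn, map_eq_vertex]
    rfl
  change conePotential g (vertex (coneOn (vertex x t)) 1)
    - conePotential g (vertex (coneOn (vertex x t)) 0) = _
  rw [h0, h1, map_eq_vertex]
  simp only [conePotential, sub_zero]
  rw [vertex_vertex, vertex_vertex]

/-! ### Simplicial sets glued from standard simplices along faces -/

theorem copies_exists_map {I : Type} {d n : ℕ} (z : (copies I d) _⦋n⦌) :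
    ∃ (k : I) (θ : ⦋n⦌ ⟶ ⦋d⦌), z = (copies I d).map θ.op (copies.gen k) := by
  obtain ⟨k, φ⟩ := z
  refine ⟨k, SSet.stdSimplex.objEquiv φ, Prod.ext rfl ?_⟩
  change φ = (Δ[d] : SSet.{0}).map (SSet.stdSimplex.objEquiv φ).op (SSet.stdSimplex.objEquiv.symm (𝟙 _))
  rw [SSet.stdSimplex.map_objEquiv_symm]
  simp

section

variable {I ι : Type} {d : ℕ} {κ κ' : ι → I} {α β : ι → Fin (d + 2)}

/-- Copies of a standard simplex, glued along faces. -/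
abbrev glueFaces (κ κ' : ι → I) (α β : ι → Fin (d + 2)) : SSet.{0} :=
  glue (copies I (d + 1)) (fun r => (copies I (d + 1)).δ (α r) (copies.gen (κ r)))
    (fun r => (copies I (d + 1)).δ (β r) (copies.gen (κ' r)))

/-- The generating simplices. -/
def glueFaces.gen (κ κ' : ι → I) (α β : ι → Fin (d + 2)) (k : I) :
    (glueFaces κ κ' α β) _⦋d + 1⦌ :=
  (glueProj _ _ _).app (op ⦋d + 1⦌) (copies.gen k)

theorem glueFaces_exists_map {n : ℕ} (y : (glueFaces κ κ' α β) _⦋n⦌) :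
    ∃ (k : I) (θ : ⦋n⦌ ⟶ ⦋d + 1⦌),
      y = (glueFaces κ κ' α β).map θ.op (glueFaces.gen κ κ' α β k) := by
  induction y using Quot.ind with
  | mk z =>
    obtain ⟨k, θ, rfl⟩ := copies_exists_map z
    exact ⟨k, θ, rfl⟩

theorem glueFaces_δ (r : ι) :
    (glueFaces κ κ' α β).δ (α r) (glueFaces.gen κ κ' α β (κ r))
      = (glueFaces κ κ' α β).δ (β r) (glueFaces.gen κ κ' α β (κ' r)) := by
  refine Quot.sound ⟨r, 𝟙 _, ?_, ?_⟩ <;>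
    exact (Functor.map_id_apply (copies I (d + 1)) (op ⦋d⦌) _).symm

/-- All identifications of vertices are generated by those of the glued faces, so agreement there
lets vertex labels descend to the quotient. -/
theorem glueFaces_exists_potential (F : I → Fin (d + 2) → ZMod 2)
    (hF : ∀ r t, F (κ r) ((α r).succAbove t) = F (κ' r) ((β r).succAbove t)) :
    ∃ g : (glueFaces κ κ' α β) _⦋0⦌ → ZMod 2,
      ∀ k t, g (vertex (glueFaces.gen κ κ' α β k) t) = F k t := by
  let h : (copies I (d + 1)) _⦋0⦌ → ZMod 2 := fun z =>
    F z.1 ((SSet.stdSimplex.objEquiv z.2).toOrderHom 0)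
  have hv : ∀ k t, h (vertex (copies.gen k) t) = F k t := fun k t => rfl
  refine ⟨Quot.lift h ?_, fun k t => hv k t⟩
  rintro _ _ ⟨r, θ, rfl, rfl⟩
  rw [map_eq_vertex, map_eq_vertex]
  refine Eq.trans (congrArg h (vertex_map (SimplexCategory.δ (α r)) (copies.gen (κ r)) _)) ?_
  refine Eq.trans ?_ (congrArg h (vertex_map (SimplexCategory.δ (β r)) (copies.gen (κ' r)) _)).symm
  rw [hv, hv]
  exact hF r _

end

/-! ### The circle inequalities for mixtures of coboundaries -/

/-- If every `b k` were `1` the total would be `N`. So some sign is `+1`, and the others contribute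
at least `-(N - 1)`. -/
theorem sum_sgn_nonneg {N : ℕ} (b : Fin N → ZMod 2) (hb : ∑ k, b k = (N : ZMod 2) + 1) :
    0 ≤ (N : ℝ) - 2 + ∑ k, sgn (b k) := by
  obtain ⟨k, hk⟩ : ∃ k, b k = 0 := by
    by_contra hne
    have h1 : ∀ k, b k = 1 := fun k =>
      (zmod_two_cases (b k)).resolve_left fun h => hne ⟨k, h⟩
    simp [h1] at hb
  rw [← Finset.add_sum_erase _ _ (Finset.mem_univ k), hk, sgn_zero]
  have h2 : ∑ _j ∈ Finset.univ.erase k, (-1 : ℝ) ≤ ∑ j ∈ Finset.univ.erase k, sgn (b j) :=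
    Finset.sum_le_sum fun j _ => by rcases sgn_eq_or (b j) with h | h <;> rw [h]; norm_num
  rw [Finset.sum_const, Finset.card_erase_of_mem (Finset.mem_univ k), Finset.card_univ,
    Fintype.card_fin, nsmul_eq_mul, Nat.cast_sub (Nat.one_le_of_lt k.2)] at h2
  push_cast at h2
  linarith

theorem zmod_two_sub (a b : ZMod 2) : a - b = a + b := by
  revert a b; decide

theorem succAbove_cases {i i' : Fin 2} (h : i ≠ i') :
    (i.succAbove (0 : Fin 1) = 0 ∧ i'.succAbove (0 : Fin 1) = 1) ∨
      (i.succAbove (0 : Fin 1) = 1 ∧ i'.succAbove (0 : Fin 1) = 0) := by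
  revert i i'; decide

/-- The first vertex of an edge of the circle in the cyclic order. -/
def circle.start {N : ℕ} (c : CircleData N) (k : Fin N) : (circle c) _⦋0⦌ :=
  vertex (circle.edge c k) ((c.i k).succAbove 0)

/-- The face `d_i` of an edge is the vertex `i.succAbove 0`, so the identifying relation says that
an edge ends where the next one starts. -/
theorem circle_vertex_end {N : ℕ} (c : CircleData N) (k : Fin N) :
    vertex (circle.edge c k) ((c.i' k).succAbove 0) = circle.start c (finRotate N k) := by
  have h := glueFaces_δ (κ := id) (κ' := finRotate N) (α := c.i')
    (β := fun k => c.i (finRotate N k)) k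
  have h1 := map_eq_vertex (SimplexCategory.δ (c.i' k)) (circle.edge c k)
  have h2 := map_eq_vertex (SimplexCategory.δ (c.i (finRotate N k))) (circle.edge c (finRotate N k))
  exact h1.symm.trans (h.trans h2)

/-- Only the laws of single edges enter the inequalities. This is used both for potentials coming
from the cone point and for those coming from a disk. -/
theorem circleInequalities_of_potentials {N : ℕ} {c : CircleData N} (p : SDist (circle c) nerveZ2)
    (d : StdSimplex ℝ ((circle c) _⦋0⦌ → ZMod 2))
    (h : ∀ e : (circle c) _⦋1⦌,
      (dist p e).map (fun a => a 0) = d.map fun g => g (vertex e 1) - g (vertex e 0)) :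
    CircleInequalities p := by
  intro a ha
  have hexp : ∀ e, expectation p e = mean d fun g => sgn (g (vertex e 1) - g (vertex e 0)) := by
    intro e
    rw [expectation_eq_mean, ← mean_map (dist p e) (fun a => a 0) sgn, h, mean_map]
  have hsum : (N : ℝ) - 2 + ∑ k, (-1) ^ (a k).val * expectation p (circle.edge c k)
      = mean d fun g => (N : ℝ) - 2 + ∑ k, sgn (a k + (g (vertex (circle.edge c k) 1)
        - g (vertex (circle.edge c k) 0))) := by
    have hc : mean d (fun _ => (N : ℝ) - 2) = N - 2 := by
      have := mean_const_mul d ((N : ℝ) - 2) fun _ => 1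
      rwa [mean_one, mul_one] at this
    rw [mean_add, hc, mean_sum]
    congr 1
    refine Finset.sum_congr rfl fun k _ => ?_
    rw [hexp, ← mean_const_mul]
    simp only [sgn_add]
    rfl
  rw [hsum]
  refine mean_nonneg fun g _ => sum_sgn_nonneg _ ?_
  rw [Finset.sum_add_distrib, ha]
  -- Modulo `2` the orientation of an edge is irrelevant, so each vertex value is counted twice
  -- around the circle and the total vanishes.
  have hk : ∀ k, g (vertex (circle.edge c k) 1) - g (vertex (circle.edge c k) 0)
      = g (circle.start c k) + g (circle.start c (finRotate N k)) := by
    intro k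
    rw [← circle_vertex_end, circle.start, zmod_two_sub]
    rcases succAbove_cases (c.ne k) with ⟨h0, h1⟩ | ⟨h0, h1⟩ <;> rw [h0, h1]
    exact add_comm _ _
  simp only [hk]
  rw [Finset.sum_add_distrib, Equiv.sum_comp (finRotate N) fun k => g (circle.start c k),
    zmod_two_double, add_zero]

theorem circleInequalities_of_nonContextual {N : ℕ} {c : CircleData N}
    {p : SDist (cycle c) nerveZ2} (h : NonContextual p) :
    CircleInequalities (coneBase (circle c) ≫ p) := by
  obtain ⟨d, rfl⟩ := h
  refine circleInequalities_of_potentials _ (d.map fun s v => outcome s (coneOn v) 0) fun e => ?_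
  change (d.map fun s => outcome (coneBase (circle c) ≫ s) e).map _ = _
  rw [StdSimplex.map_map, StdSimplex.map_map]
  simp only [outcome_coneBase]
  rfl

/-! ### Fine's theorem for the cycle scenario -/

/-- The index of the circle that is congruent to a natural number. -/
def cyclicIndex {N : ℕ} (hN : 1 ≤ N) (k : ℕ) : Fin N := ⟨k % N, Nat.mod_lt _ hN⟩

theorem finRotate_cyclicIndex {N : ℕ} (hN : 1 ≤ N) (k : ℕ) :
    finRotate N (cyclicIndex hN k) = cyclicIndex hN (k + 1) := by
  obtain ⟨n, rfl⟩ : ∃ n, N = n + 1 := ⟨N - 1, by omega⟩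
  rw [finRotate_apply]
  ext
  simp [cyclicIndex, Fin.val_add]

theorem cyclicIndex_val {N : ℕ} (hN : 1 ≤ N) (k : Fin N) : cyclicIndex hN k = k :=
  Fin.ext (Nat.mod_eq_of_lt k.2)

theorem cycle_exists_map {N : ℕ} (hN : 1 ≤ N) (c : CircleData N) {n : ℕ} (y : (cycle c) _⦋n⦌) :
    ∃ (k : Fin N) (θ : ⦋n⦌ ⟶ ⦋2⦌), y = (cycle c).map θ.op (coneOn (circle.edge c k)) := by
  change ConeSimplex (circle c) n at y
  cases y with
  | apex => exact ⟨cyclicIndex hN 0, _, (map_const_coneOn _).symm⟩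
  | upper s l h x =>
    obtain ⟨k, θ, rfl⟩ := glueFaces_exists_map (κ := id) (κ' := finRotate N) (α := c.i')
      (β := fun k => c.i (finRotate N k)) x
    exact ⟨k, _, (map_joinMap_coneOn h θ _).symm⟩

/-- The values at the two ends of the base edge, relative to the cone point, determine the outcome
on a triangle of the cone. Laws on triangles may therefore be compared as laws of pairs. -/
theorem endpoints_injective {i i' : Fin 2} (h : i ≠ i') : Function.Injective fun a : Fin 2 → ZMod 2 =>
    (partialSum a (i.succAbove (0 : Fin 1)).succ, partialSum a (i'.succAbove (0 : Fin 1)).succ) := by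
  intro a b hab
  simp only [Prod.mk.injEq] at hab
  obtain ⟨h1, h2⟩ := hab
  have key : partialSum a 1 = partialSum b 1 ∧ partialSum a 2 = partialSum b 2 := by
    rcases succAbove_cases h with ⟨h0, h0'⟩ | ⟨h0, h0'⟩ <;> rw [h0] at h1 <;> rw [h0'] at h2
    · exact ⟨h1, h2⟩
    · exact ⟨h2, h1⟩
  refine partialSum_injective (funext fun t => ?_)
  fin_cases t
  · exact (partialSum_zero a).trans (partialSum_zero b).symm
  · exact key.1
  · exact key.2

theorem map_injective {α β : Type} {f : α → β} (hf : Function.Injective f) {w w' : StdSimplex ℝ α}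
    (h : w.map f = w'.map f) : w = w' := by
  have : Nonempty α := w.nonempty
  have h' := congrArg (StdSimplex.map (Function.invFun f)) h
  rw [StdSimplex.map_map, StdSimplex.map_map] at h'
  simpa only [Function.leftInverse_invFun hf _, ← Function.id_def, StdSimplex.map_id] using h'

theorem nonContextual_of_circleInequalities {N : ℕ} (hN : 1 ≤ N) {c : CircleData N}
    {p : SDist (cycle c) nerveZ2} (h : CircleInequalities (coneBase (circle c) ≫ p)) :
    NonContextual p := by
  set ends : Fin N → (Fin 2 → ZMod 2) → ZMod 2 × ZMod 2 := fun k a =>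
    (partialSum a ((c.i k).succAbove (0 : Fin 1)).succ,
      partialSum a ((c.i' k).succAbove (0 : Fin 1)).succ) with hends
  set q : ℕ → StdSimplex ℝ (ZMod 2 × ZMod 2) := fun k =>
    (dist p (coneOn (circle.edge c (cyclicIndex hN k)))).map (ends (cyclicIndex hN k)) with hqdef
  have hfst : ∀ k, (q k).map Prod.fst
      = (dist p (coneOn (circle.start c (cyclicIndex hN k)))).map fun a => a 0 := fun k => by
    rw [circle.start, dist_coneOn_vertex, hqdef, StdSimplex.map_map]
  have hsnd : ∀ k, (q k).map Prod.snd
      = (dist p (coneOn (circle.start c (cyclicIndex hN (k + 1))))).map fun a => a 0 := fun k => by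
    rw [← finRotate_cyclicIndex, ← circle_vertex_end, dist_coneOn_vertex, hqdef, StdSimplex.map_map]
  have hq : ∀ k, (q k).map Prod.snd = (q (k + 1)).map Prod.fst := fun k => by rw [hsnd, hfst]
  have hcyc : (q N).map Prod.fst = (q 0).map Prod.fst := by
    rw [hfst, hfst]
    simp [cyclicIndex]
  have hmean : ∀ k, mean (q k) (fun z => sgn z.1 * sgn z.2)
      = expectation (coneBase (circle c) ≫ p) (circle.edge c (cyclicIndex hN k)) := fun k => by
    rw [expectation_eq_mean, dist_coneBase, mean_map, mean_map]
    congr 1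
    funext a
    rw [← sgn_add, hends]
    change _ = sgn (partialSum a (1 : Fin 2).succ - partialSum a (0 : Fin 2).succ)
    rw [zmod_two_sub]
    rcases succAbove_cases (c.ne (cyclicIndex hN k)) with ⟨h0, h1⟩ | ⟨h0, h1⟩ <;> simp only [h0, h1]
    rw [add_comm]
  obtain ⟨W, hW, hWN⟩ := exists_cycle q hq N hcyc fun a ha => by
    have := h (fun k => a k) (by rw [← ha, Finset.sum_range])
    rw [Finset.sum_range]
    simp only [hmean, cyclicIndex_val]
    exact this
  -- The start of edge `k` gets the value `x k` and its end the value at the rotated index, which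
  -- makes the labels consistent for every `x`, closed up or not.
  have hpot : ∀ x : ℕ → ZMod 2, ∃ g : (circle c) _⦋0⦌ → ZMod 2,
      ∀ k : Fin N, ∀ t, g (vertex (circle.edge c k) t)
        = if t = (c.i k).succAbove (0 : Fin 1) then x k else x (finRotate N k) := fun x =>
    glueFaces_exists_potential (κ := id) (κ' := finRotate N) (α := c.i')
      (β := fun k => c.i (finRotate N k))
      (fun k t => if t = (c.i k).succAbove (0 : Fin 1) then x k else x (finRotate N k))
      fun k t => by
        obtain rfl : t = 0 := Fin.fin_one_eq_zero t
        have hne : (c.i' k).succAbove (0 : Fin 1) ≠ (c.i k).succAbove (0 : Fin 1) := by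
          rcases succAbove_cases (c.ne k) with ⟨h0, h1⟩ | ⟨h0, h1⟩ <;> rw [h0, h1] <;> decide
        rw [if_pos rfl, id, if_neg hne]
  choose G hG using hpot
  refine ⟨W.map fun x => coboundary (conePotential (G x)), dist_ext fun n y => ?_⟩
  obtain ⟨k, θ, rfl⟩ := cycle_exists_map hN c y
  rw [dist_map, dist_map]
  congr 1
  rw [dist_Theta, StdSimplex.map_map]
  refine map_injective (endpoints_injective (c.ne k)) ?_
  rw [StdSimplex.map_map]
  have hqk := hW k k.2
  rw [hqdef] at hqk
  simp only [cyclicIndex_val] at hqk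
  refine Eq.trans (map_congr_support fun x hx => ?_) hqk
  -- For the last edge this is the closing condition `x N = x 0`, available only on the support of
  -- `W`.
  have hrot : x (finRotate N k) = x (k + 1) := by
    rw [← cyclicIndex_val hN k, finRotate_cyclicIndex, cyclicIndex_val]
    rcases Nat.lt_or_ge ((k : ℕ) + 1) N with hk | hk
    · simp [cyclicIndex, Nat.mod_eq_of_lt hk]
    · have hk' : (k : ℕ) + 1 = N := le_antisymm k.2 hk
      rw [hk', hWN x hx]
      simp [cyclicIndex]
  have hne : (c.i' k).succAbove (0 : Fin 1) ≠ (c.i k).succAbove (0 : Fin 1) := by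
    rcases succAbove_cases (c.ne k) with ⟨h0, h1⟩ | ⟨h0, h1⟩ <;> rw [h0, h1] <;> decide
  rw [partialSum_outcome_conePotential, partialSum_outcome_conePotential, hG, hG, if_pos rfl,
    if_neg hne, hrot]

/-! ### The classical disk -/

/-- A simplicial distribution on the classical disk is a mixture of coboundaries. -/
theorem disk_exists_potentials {N : ℕ} (hN : 3 ≤ N) {D : DiskData N} (P : SDist (disk D) nerveZ2) :
    ∃ d : StdSimplex ℝ ((disk D) _⦋0⦌ → ZMod 2), ∀ e : (disk D) _⦋1⦌,
      (dist P e).map (fun a => a 0) = d.map fun g => g (vertex e 1) - g (vertex e 0) := by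
  have hm : 1 ≤ N - 2 := by omega
  have hidx : ∀ (k : ℕ) (h : k < N - 2), cyclicIndex hm k = ⟨k, h⟩ := fun k h =>
    Fin.ext (Nat.mod_eq_of_lt h)
  let κ : {k : Fin (N - 2) // (k : ℕ) + 1 < N - 2} → Fin (N - 2) := fun k => k.1
  let κ' : {k : Fin (N - 2) // (k : ℕ) + 1 < N - 2} → Fin (N - 2) := fun k => ⟨k.1 + 1, k.2⟩
  let α : {k : Fin (N - 2) // (k : ℕ) + 1 < N - 2} → Fin 3 := fun k => D.j' k
  let β : {k : Fin (N - 2) // (k : ℕ) + 1 < N - 2} → Fin 3 := fun k => D.j ⟨k.1 + 1, k.2⟩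
  let r : ℕ → (Fin 2 → ZMod 2) → Fin 1 → ZMod 2 := fun k =>
    nerveMap (SimplexCategory.δ (D.j' (cyclicIndex hm k)) : ⦋1⦌ ⟶ ⦋2⦌).toOrderHom
  let l : ℕ → (Fin 2 → ZMod 2) → Fin 1 → ZMod 2 := fun k =>
    nerveMap (SimplexCategory.δ (D.j (cyclicIndex hm (k + 1))) : ⦋1⦌ ⟶ ⦋2⦌).toOrderHom
  obtain ⟨W, hW, hWc⟩ := exists_chain (fun k => dist P (disk.triangle D (cyclicIndex hm k))) r l
    (N - 3) fun k hk => by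
      have h := glueFaces_δ (κ := κ) (κ' := κ') (α := α) (β := β)
        ⟨⟨k, by omega⟩, by simp only; omega⟩
      change (disk D).map (SimplexCategory.δ _).op (disk.triangle D ⟨k, _⟩)
        = (disk D).map (SimplexCategory.δ _).op (disk.triangle D ⟨k + 1, _⟩) at h
      have h' := congrArg (dist P) h
      rw [dist_map, dist_map] at h'
      simp only [r, l, hidx k (by omega), hidx (k + 1) (by omega)]
      exact h'
  have hpot : ∀ x : ℕ → Fin 2 → ZMod 2, ∃ g : (disk D) _⦋0⦌ → ZMod 2,
      (∀ k < N - 3, r k (x k) = l k (x (k + 1))) → ∀ (k : Fin (N - 2)) (t s : Fin 3),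
        g (vertex (disk.triangle D k) t) - g (vertex (disk.triangle D k) s)
          = partialSum (x k) t - partialSum (x k) s := by
    intro x
    by_cases hx : ∀ k < N - 3, r k (x k) = l k (x (k + 1))
    swap
    -- Sequences that do not match lie outside the support of `W`, so their potential is arbitrary.
    · exact ⟨0, fun h => absurd h hx⟩
    -- Each triangle has a local potential vanishing at its vertex `0`. Across a shared edge,
    -- neighbouring potentials differ by a constant, and `C k` accumulates these constants; a chain
    -- has no cycle to obstruct this.
    let C : ℕ → ZMod 2 := fun k => ∑ j ∈ Finset.range k,
      (partialSum (x j) ((D.j' (cyclicIndex hm j)).succAbove (0 : Fin 2))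
        - partialSum (x (j + 1)) ((D.j (cyclicIndex hm (j + 1))).succAbove (0 : Fin 2)))
    obtain ⟨g, hg⟩ := glueFaces_exists_potential (κ := κ) (κ' := κ') (α := α) (β := β)
      (fun k t => partialSum (x k) t + C k) (by
        rintro ⟨⟨k, hk⟩, hk'⟩ t
        have hk'' : k + 1 < N - 2 := hk'
        have h := congrArg (fun a => partialSum a t) (hx k (by omega))
        simp only [r, l, partialSum_nerveMap, hidx k hk, hidx (k + 1) hk''] at h
        have hC : C (k + 1) = C k + (partialSum (x k) ((D.j' ⟨k, hk⟩).succAbove (0 : Fin 2))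
            - partialSum (x (k + 1)) ((D.j ⟨k + 1, hk''⟩).succAbove (0 : Fin 2))) := by
          simp only [C, Finset.sum_range_succ, hidx k hk, hidx (k + 1) hk'']
        change partialSum (x k) ((D.j' ⟨k, hk⟩).succAbove t) + C k
          = partialSum (x (k + 1)) ((D.j ⟨k + 1, hk''⟩).succAbove t) + C (k + 1)
        change partialSum (x k) ((D.j' ⟨k, hk⟩).succAbove t)
            - partialSum (x k) ((D.j' ⟨k, hk⟩).succAbove (0 : Fin 2))
          = partialSum (x (k + 1)) ((D.j ⟨k + 1, hk''⟩).succAbove t)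
            - partialSum (x (k + 1)) ((D.j ⟨k + 1, hk''⟩).succAbove (0 : Fin 2)) at h
        rw [hC]
        linear_combination h)
    refine ⟨g, fun _ k t s => ?_⟩
    have ht : ∀ t, g (vertex (disk.triangle D k) t) = partialSum (x k) t + C k := hg k
    exact (congrArg₂ (· - ·) (ht t) (ht s)).trans (by ring)
  choose G hG using hpot
  refine ⟨W.map G, fun e => ?_⟩
  obtain ⟨k, θ, he⟩ := glueFaces_exists_map (κ := κ) (κ' := κ') (α := α) (β := β) e
  change e = (disk D).map θ.op (disk.triangle D k) at he
  have hk := hW k (by omega)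
  rw [cyclicIndex_val] at hk
  rw [he, dist_map, ← hk, StdSimplex.map_map, StdSimplex.map_map, StdSimplex.map_map]
  refine map_congr_support fun x hx => ?_
  rw [vertex_map, vertex_map, hG x (hWc x hx), nerveMap_eq]
  rfl

/-! ### Fine's theorem -/

/-- Each assignment in the mixture restricts to a coboundary on `X`. Its potential extends along an
injection of vertices, by zero elsewhere, and the same weights mix the resulting coboundaries on
`Z`. -/
theorem exists_extension_of_nonContextual {X Z : SSet.{0}} (f : X ⟶ Z)
    (hf : Function.Injective (f.app (op ⦋0⦌))) {p : SDist (cone X) nerveZ2}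
    (h : NonContextual p) :
    ∃ P : SDist (Limits.pushout (coneBase X) f) nerveZ2,
      Limits.pushout.inl (coneBase X) f ≫ P = p := by
  obtain ⟨d, rfl⟩ := h
  have hext : ∀ s : cone X ⟶ nerveZ2, ∃ g : Z _⦋0⦌ → ZMod 2,
      ∀ v, g (f.app (op ⦋0⦌) v) = outcome s (coneOn v) 0 := fun s =>
    ⟨Function.extend (f.app (op ⦋0⦌)) (fun v => outcome s (coneOn v) 0) 0,
      fun v => hf.extend_apply _ _ v⟩
  choose G hG using hext
  refine ⟨Limits.pushout.desc (Theta d) (Theta (d.map fun s => coboundary (G s)))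
    (dist_ext fun n x => ?_), Limits.pushout.inl_desc _ _ _⟩
  rw [dist_comp f, dist_Theta, StdSimplex.map_map]
  change (d.map fun s => outcome (coneBase X ≫ s) x) = _
  congr 1
  funext s
  rw [outcome_coneBase, outcome_coboundary]
  congr 1
  funext t
  rw [vertex_app, hG]

theorem circleToDisk_injective {N : ℕ} {c : CircleData N} {D : DiskData N}
    (e : circle c ≅ (diskBoundary D : SSet.{0})) :
    Function.Injective ((circleToDisk e).app (op ⦋0⦌)) := by
  have : Mono (circleToDisk e) := by
    unfold circleToDisk
    infer_instance
  rw [← mono_iff_injective]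
  infer_instance

/-- In the pushout the base of the cone also lies in the disk, where the distribution is a mixture
of coboundaries; pulling the potentials back along `f` gives the circle inequalities. -/
theorem nonContextual_of_extension {N : ℕ} (hN : 3 ≤ N) {c : CircleData N} {D : DiskData N}
    (f : circle c ⟶ disk D) (P : SDist (Limits.pushout (coneBase (circle c)) f) nerveZ2) :
    NonContextual (Limits.pushout.inl (coneBase (circle c)) f ≫ P) := by
  obtain ⟨d, hd⟩ := disk_exists_potentials hN (Limits.pushout.inr (coneBase (circle c)) f ≫ P)
  refine nonContextual_of_circleInequalities (by omega) ?_
  rw [← Category.assoc, Limits.pushout.condition, Category.assoc]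
  refine circleInequalities_of_potentials _ (d.map fun g v => g (f.app (op ⦋0⦌) v)) fun e => ?_
  rw [dist_comp, hd, StdSimplex.map_map]
  simp only [vertex_app]

end SimplicialDist

end

open SimplicialDist in
theorem mainTheorem2 (N : ℕ) (hN : 1 ≤ N) (c : CircleData N) (p : SDist (cycle c) nerveZ2) :
    (NonContextual p ↔ CircleInequalities (coneBase (circle c) ≫ p)) ∧
    (3 ≤ N → ∀ (D : DiskData N) (e : circle c ≅ (diskBoundary D : SSet.{0})),
      (NonContextual p ↔
        ∃ P : SDist (cycleWithDisk e) nerveZ2,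
          Limits.pushout.inl (coneBase (circle c)) (circleToDisk e) ≫ P = p)) := by
  refine ⟨⟨circleInequalities_of_nonContextual, nonContextual_of_circleInequalities hN⟩,
    fun h3 D e => ⟨exists_extension_of_nonContextual _ (circleToDisk_injective e), ?_⟩⟩
  rintro ⟨P, rfl⟩
  exact nonContextual_of_extension h3 _ P
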